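/- Let $n\ge 2$. Let $(\Sigma,g)$ be an oriented smooth Riemannian $n$-manifold (without boundary) with volume form $\mathsf{vol}$ and Hodge star $\ast$, and let $(M,h)$ be a smooth Riemannian $m$-manifold, $m\ge n$, equipped with a smooth $(n-1)$-fold vector cross product $Q$: a smooth section of $\Lambda^{n-1}T^*M\otimes TM$ such that $Q(w_1\wedge\cdots\wedge w_{n-1})$ is orthogonal to $w_1,\dots,w_{n-1}$ and $|Q(w_1\wedge\cdots\wedge w_{n-1})|^2=|w_1\wedge\cdots\wedge w_{n-1}|^2=\det\big(h(w_i,w_j)\big)$ for all tangent vectors $w_1,\dots,w_{n-1}$ at a point. Let $\alpha$ be the associated calibration $n$-form, $\alpha(w_1,\dots,w_n)=h(Q(w_1\wedge\cdots\wedge w_{n-1}),w_n)$. A smooth map $u:\Sigma\to M$ is a Smith map if at each $x\in\Sigma$ there is $\lambda>0$ with $$Q\,(\Lambda^{n-1}du_x)=\lambda^{n-2}\,du_x\,\ast \qquad\text{on } \Lambda^{n-1}T_x\Sigma ,$$ and it is $n$-harmonic if the section $|du|^{n-2}du$ of $T^*\Sigma\otimes u^*TM$ is $C^1$ and $\operatorname{div}(|du|^{n-2}du)=0$.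 Here $|du|$ is the Hilbert–Schmidt norm, and $\operatorname{div}B=\operatorname{tr}_g\nabla B$ for a section $B$ of $T^*\Sigma\otimes u^*TM$, where $\nabla$ is the tensor product of the Levi-Civita connection of $g$ and the pullback by $u$ of the Levi-Civita connection of $h$. Suppose that $d\alpha=0$, and let $u:\Sigma\to M$ be a smooth Smith map. Then the section $Q(\Lambda^{n-1}du)\ast$ of $T^*\Sigma\otimes u^*TM$ (with $\ast:T\Sigma\to\Lambda^{n-1}T\Sigma$) is $C^1$ and satisfies $$\operatorname{div}\big(Q(\Lambda^{n-1}du)\ast\big)=0,$$ and $u$ is $n$-harmonic. -/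

import Mathlib

open Bundle Manifold ContDiff Topology
open scoped RealInnerProductSpace

noncomputable section

/-! ### Linear algebra of vector cross products -/

section LinearAlgebra

variable {V : Type*} [NormedAddCommGroup V] [InnerProductSpace ℝ V]
  {W : Type*} [NormedAddCommGroup W] [InnerProductSpace ℝ W]

/-- A `k`-fold vector cross product on the Euclidean space `W`, where `1 ≤ k ≤ dim W - 1`: an
alternating map `P` with `P (v₁, …, vₖ)` orthogonal to every `vᵢ` and
`|P (v₁, …, vₖ)|² = |v₁ ∧ ⋯ ∧ vₖ|²`, the latter being the Gram determinant `det ⟨vᵢ, vⱼ⟩`. -/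
structure VectorCrossProduct (k : ℕ) (W : Type*) [NormedAddCommGroup W]
    [InnerProductSpace ℝ W] where
  toAlt : W [⋀^Fin k]→L[ℝ] W
  one_le : 1 ≤ k
  lt_finrank : k < Module.finrank ℝ W
  orthogonal : ∀ (v : Fin k → W) (i : Fin k), ⟪toAlt v, v i⟫ = 0
  norm_sq : ∀ v : Fin k → W, ‖toAlt v‖ ^ 2 = (Matrix.of fun i j : Fin k => ⟪v i, v j⟫).det

/-- The calibration `(k+1)`-form `α (v₁, …, vₖ₊₁) = ⟨P (v₁, …, vₖ), vₖ₊₁⟩` of a `k`-fold vector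
cross product `P`. -/
def VectorCrossProduct.calibrationForm {k : ℕ} (P : VectorCrossProduct k W) :
    W [⋀^Fin (k + 1)]→L[ℝ] ℝ where
  toFun v := ⟪P.toAlt (Fin.init v), v (Fin.last k)⟫
  map_update_add' := by
    intro inst v i x y
    obtain rfl : inst = instDecidableEqFin (k + 1) := Subsingleton.elim _ _
    induction i using Fin.lastCases with
    | last => simp [inner_add_right]
    | cast j =>
      have h : Fin.last k ≠ j.castSucc := (Fin.castSucc_lt_last j).ne'
      simp [Fin.init_update_castSucc, inner_add_left, Function.update_of_ne h]
  map_update_smul' := by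
    intro inst v i c x
    obtain rfl : inst = instDecidableEqFin (k + 1) := Subsingleton.elim _ _
    induction i using Fin.lastCases with
    | last => simp [inner_smul_right]
    | cast j =>
      have h : Fin.last k ≠ j.castSucc := (Fin.castSucc_lt_last j).ne'
      simp [Fin.init_update_castSucc, inner_smul_left, Function.update_of_ne h]
  map_eq_zero_of_eq' := by
    intro v i j hij hne
    have key : ∀ l : Fin k, v l.castSucc = v (Fin.last k) →
        ⟪P.toAlt (Fin.init v), v (Fin.last k)⟫ = 0 := fun l hl => by
      rw [← hl]; exact P.orthogonal (Fin.init v) l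
    induction i using Fin.lastCases with
    | last =>
      induction j using Fin.lastCases with
      | last => exact absurd rfl hne
      | cast j => exact key j hij.symm
    | cast i =>
      induction j using Fin.lastCases with
      | last => exact key i hij
      | cast j =>
        have : P.toAlt (Fin.init v) = 0 :=
          P.toAlt.map_eq_zero_of_eq (Fin.init v) hij (fun h => hne (by rw [h]))
        simp [this]
  cont := by
    have h : Continuous fun v : Fin (k + 1) → W => (Fin.init v : Fin k → W) :=
      continuous_pi fun i => continuous_apply i.castSucc
    exact (P.toAlt.cont.comp h).inner (continuous_apply (Fin.last k))

variable [FiniteDimensional ℝ V]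

/-- The Hilbert–Schmidt norm `|A| = (∑ₗ |A eₗ|²)^{1/2}`, for an orthonormal basis `(eₗ)`. -/
def hilbertSchmidtNorm (A : V →ₗ[ℝ] W) : ℝ :=
  √(∑ l, ‖A (stdOrthonormalBasis ℝ V l)‖ ^ 2)

/-- The linear map `|A|^(q-2) A`. -/
def scaledMap (q : ℕ) (A : V →ₗ[ℝ] W) : V →ₗ[ℝ] W :=
  hilbertSchmidtNorm A ^ (q - 2) • A

/-- The Hodge star `∗ : Λᵏ V → V` of an oriented Euclidean `(k+1)`-space, as an alternating map:
`⟨∗(v₁ ∧ ⋯ ∧ vₖ), w⟩ = vol (v₁, …, vₖ, w)`. -/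
def hodgeStar {k : ℕ} [Fact (Module.finrank ℝ V = k + 1)] (o : Orientation ℝ V (Fin (k + 1))) :
    V [⋀^Fin k]→ₗ[ℝ] V where
  toFun v := ∑ l, o.volumeForm (Fin.snoc v (stdOrthonormalBasis ℝ V l) : Fin (k + 1) → V) •
    stdOrthonormalBasis ℝ V l
  map_update_add' := by
    intro inst v i x y
    obtain rfl : inst = instDecidableEqFin k := Subsingleton.elim _ _
    simp only [Fin.snoc_update, AlternatingMap.map_update_add, add_smul, Finset.sum_add_distrib]
  map_update_smul' := by
    intro inst v i c x
    obtain rfl : inst = instDecidableEqFin k := Subsingleton.elim _ _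
    simp only [Fin.snoc_update, AlternatingMap.map_update_smul, smul_eq_mul, mul_smul,
      Finset.smul_sum]
  map_eq_zero_of_eq' := by
    intro v i j hij hne
    refine Finset.sum_eq_zero fun l _ => ?_
    rw [o.volumeForm.map_eq_zero_of_eq _ (i := i.castSucc) (j := j.castSucc) (by simpa using hij)
      (fun h => hne (Fin.castSucc_injective k h)), zero_smul]

/-- The Hodge star `∗ : V → Λᵏ V` of an oriented Euclidean `(k+1)`-space:
`∗w = (1/k!) ∑ vol (w, e_{i₁}, …, e_{iₖ}) e_{i₁} ∧ ⋯ ∧ e_{iₖ}`, for an orthonormal basis `(eₗ)`. -/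
def hodgeStarVec {k : ℕ} [Fact (Module.finrank ℝ V = k + 1)]
    (o : Orientation ℝ V (Fin (k + 1))) : V →ₗ[ℝ] ⋀[ℝ]^k V where
  toFun w := (k.factorial : ℝ)⁻¹ • ∑ i : Fin k → Fin (Module.finrank ℝ V),
    o.volumeForm.curryLeft w (fun r => stdOrthonormalBasis ℝ V (i r)) •
      exteriorPower.ιMulti ℝ k (fun r => stdOrthonormalBasis ℝ V (i r))
  map_add' x y := by
    simp only [map_add, AlternatingMap.add_apply, add_smul, Finset.sum_add_distrib, smul_add]
  map_smul' c x := by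
    simp only [map_smul, AlternatingMap.smul_apply, smul_assoc, ← Finset.smul_sum,
      RingHom.id_apply]
    rw [smul_comm]

/-- `A : V → W` is a Smith map for the alternating maps `P` and `Q` when
`Q (Λᵏ A) = λ^(k-1) A P` for some `λ > 0`. -/
def IsLinearSmithMap {k : ℕ} (P : V [⋀^Fin k]→ₗ[ℝ] V) (Q : W [⋀^Fin k]→ₗ[ℝ] W)
    (A : V →ₗ[ℝ] W) : Prop :=
  ∃ c : ℝ, 0 < c ∧
    exteriorPower.alternatingMapLinearEquiv Q ∘ₗ exteriorPower.map k A =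
      c ^ (k - 1) • (A ∘ₗ exteriorPower.alternatingMapLinearEquiv P)

/-- The linear map `Q (Λᵏ A) ∗ : V → W`. -/
def crossStar {k : ℕ} [Fact (Module.finrank ℝ V = k + 1)] (o : Orientation ℝ V (Fin (k + 1)))
    (Q : W [⋀^Fin k]→ₗ[ℝ] W) (A : V →ₗ[ℝ] W) : V →ₗ[ℝ] W :=
  exteriorPower.alternatingMapLinearEquiv Q ∘ₗ exteriorPower.map k A ∘ₗ hodgeStarVec o

end LinearAlgebra

/-! ### Coordinates on a manifold

All manifolds are modelled on `ℝⁿ`, without boundary. -/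

/-- The Euclidean space `ℝⁿ`. -/
abbrev Euc (n : ℕ) : Type := EuclideanSpace ℝ (Fin n)

section Coordinates

variable {n : ℕ} {M : Type*} [TopologicalSpace M] [ChartedSpace (Euc n) M]

instance instFiniteDimensionalTangentSpaceEuc (x : M) :
    FiniteDimensional ℝ (TangentSpace (𝓡 n) x) :=
  inferInstanceAs (FiniteDimensional ℝ (Euc n))

instance instFactFinrankTangentSpaceEuc (x : M) :
    Fact (Module.finrank ℝ (TangentSpace (𝓡 n) x) = n) :=
  ⟨finrank_euclideanSpace_fin (𝕜 := ℝ) (n := n)⟩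

variable [IsManifold (𝓡 n) ∞ M]

/-- The map `ℝⁿ → T_x M` that sends the standard basis to the coordinate frame at `x` of the chart
around `p`. -/
def frame (p x : M) : Euc n →L[ℝ] TangentSpace (𝓡 n) x :=
  (trivializationAt (Euc n) (fun y : M => TangentSpace (𝓡 n) y) p).symmL ℝ x

/-- The coordinates `T_x M → ℝⁿ` of a tangent vector at `x` in the chart around `p`. -/
def coframe (p x : M) : TangentSpace (𝓡 n) x →L[ℝ] Euc n :=
  (trivializationAt (Euc n) (fun y : M => TangentSpace (𝓡 n) y) p).continuousLinearMapAt ℝ x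

/-- The coordinate vector `∂ᵢ` at `x` of the chart around `p`. -/
def coordVec (p x : M) (i : Fin n) : TangentSpace (𝓡 n) x :=
  frame p x (EuclideanSpace.single i 1)

/-- The partial derivative `∂ᵢ f` at `z`. -/
def partialDeriv (i : Fin n) (f : Euc n → ℝ) (z : Euc n) : ℝ :=
  fderiv ℝ f z (EuclideanSpace.single i 1)

/-- A choice of orientations of the tangent spaces that is locally constant, i.e. an orientation
of the manifold. -/
def IsManifoldOrientation (o : ∀ x : M, Orientation ℝ (TangentSpace (𝓡 n) x) (Fin n)) : Prop :=
  ∀ p : M, ∀ᶠ x in 𝓝 p,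
    ∀ hx : x ∈ (trivializationAt (Euc n) (fun y : M => TangentSpace (𝓡 n) y) p).baseSet,
      Orientation.map (Fin n) ((trivializationAt (Euc n)
          (fun y : M => TangentSpace (𝓡 n) y) p).continuousLinearEquivAt ℝ x hx).toLinearEquiv
          (o x) =
        Orientation.map (Fin n) ((trivializationAt (Euc n)
          (fun y : M => TangentSpace (𝓡 n) y) p).continuousLinearEquivAt ℝ p
          (FiberBundle.mem_baseSet_trivializationAt' p)).toLinearEquiv (o p)

/-- A differential `r`-form is closed when, in every chart, the exterior derivative of its
coordinate expression vanishes. -/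
def IsClosedForm {r : ℕ} (α : ∀ x : M, TangentSpace (𝓡 n) x [⋀^Fin r]→L[ℝ] ℝ) : Prop :=
  ∀ p : M, ∀ z ∈ (extChartAt (𝓡 n) p).target,
    extDeriv (fun z' => (α ((extChartAt (𝓡 n) p).symm z')).compContinuousLinearMap
      (frame p ((extChartAt (𝓡 n) p).symm z'))) z = 0

variable [RiemannianBundle (fun x : M => TangentSpace (𝓡 n) x)]

/-- A family of `k`-fold vector cross products on the tangent spaces is smooth when, in every
chart, its coordinate expression is smooth, i.e. it is a smooth section of `Λᵏ T*M ⊗ TM`. -/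
def IsSmoothVCP {k : ℕ} (Q : ∀ y : M, VectorCrossProduct k (TangentSpace (𝓡 n) y)) : Prop :=
  ∀ (p : M) (v : Fin k → Euc n),
    ContDiffOn ℝ ∞ (fun z => coframe p ((extChartAt (𝓡 n) p).symm z)
      ((Q ((extChartAt (𝓡 n) p).symm z)).toAlt
        fun r => frame p ((extChartAt (𝓡 n) p).symm z) (v r))) (extChartAt (𝓡 n) p).target

/-- The matrix `(g_{ij})` of the metric in the chart around `p`, at the point with coordinates
`z`. -/
def metricMatrix (p : M) (z : Euc n) : Matrix (Fin n) (Fin n) ℝ :=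
  Matrix.of fun i j => ⟪coordVec p ((extChartAt (𝓡 n) p).symm z) i,
    coordVec p ((extChartAt (𝓡 n) p).symm z) j⟫

/-- The Christoffel symbol
`Γᵃ_{ij} = ½ ∑ₗ g^{al} (∂ᵢ g_{jl} + ∂ⱼ g_{il} - ∂ₗ g_{ij})` of the Levi-Civita connection in the
chart around `p`, at the point with coordinates `z`. -/
def christoffel (p : M) (z : Euc n) (a i j : Fin n) : ℝ :=
  (1 / 2) * ∑ l, (metricMatrix p z)⁻¹ a l *
    (partialDeriv i (fun z' => metricMatrix p z' j l) z +
      partialDeriv j (fun z' => metricMatrix p z' i l) z -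
      partialDeriv l (fun z' => metricMatrix p z' i j) z)

end Coordinates

/-! ### Maps between Riemannian manifolds -/

section Maps

variable {n m : ℕ}
  {S : Type*} [TopologicalSpace S] [ChartedSpace (Euc n) S] [IsManifold (𝓡 n) ∞ S]
  {M : Type*} [TopologicalSpace M] [ChartedSpace (Euc m) M] [IsManifold (𝓡 m) ∞ M]

/-- The components `Bᵃⱼ` of a section `B` of `T*S ⊗ u*TM`, in the charts around `p` and `u p`. -/
def sectionCoord (u : S → M)
    (B : ∀ x : S, TangentSpace (𝓡 n) x →ₗ[ℝ] TangentSpace (𝓡 m) (u x))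
    (p : S) (a : Fin m) (j : Fin n) (z : Euc n) : ℝ :=
  coframe (u p) (u ((extChartAt (𝓡 n) p).symm z))
    (B ((extChartAt (𝓡 n) p).symm z) (coordVec p ((extChartAt (𝓡 n) p).symm z) j)) a

/-- The coordinate expression `uᵃ` of the map `u` in the charts around `p` and `u p`. -/
def mapCoord (u : S → M) (p : S) (a : Fin m) (z : Euc n) : ℝ :=
  extChartAt (𝓡 m) (u p) (u ((extChartAt (𝓡 n) p).symm z)) a

/-- A section of `T*S ⊗ u*TM` is `C¹` when its components in charts are. -/
def IsC1Section (u : S → M)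
    (B : ∀ x : S, TangentSpace (𝓡 n) x →ₗ[ℝ] TangentSpace (𝓡 m) (u x)) : Prop :=
  ∀ (p : S) (a : Fin m) (j : Fin n),
    ContDiffAt ℝ 1 (sectionCoord u B p a j) (extChartAt (𝓡 n) p p)

variable [RiemannianBundle (fun x : S => TangentSpace (𝓡 n) x)]
  [RiemannianBundle (fun y : M => TangentSpace (𝓡 m) y)]

/-- The component `(∇ᵢ B)ᵃⱼ = ∂ᵢ Bᵃⱼ - ∑ Γˡ_{ij} Bᵃₗ + ∑ Γᵃ_{bc}(u) ∂ᵢ uᵇ Bᶜⱼ` at `p` of the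
covariant derivative of a section `B` of `T*S ⊗ u*TM`, for the tensor product of the Levi-Civita
connection on `T*S` and the pullback by `u` of the Levi-Civita connection on `TM`, in the charts
around `p` and `u p`. -/
def covDerivCoord (u : S → M)
    (B : ∀ x : S, TangentSpace (𝓡 n) x →ₗ[ℝ] TangentSpace (𝓡 m) (u x))
    (p : S) (i : Fin n) (a : Fin m) (j : Fin n) : ℝ :=
  partialDeriv i (sectionCoord u B p a j) (extChartAt (𝓡 n) p p)
    - ∑ l, christoffel p (extChartAt (𝓡 n) p p) l i j *
        sectionCoord u B p a l (extChartAt (𝓡 n) p p)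
    + ∑ b, ∑ c, christoffel (u p) (extChartAt (𝓡 m) (u p) (u p)) a b c *
        partialDeriv i (mapCoord u p b) (extChartAt (𝓡 n) p p) *
        sectionCoord u B p c j (extChartAt (𝓡 n) p p)

/-- The Riemannian divergence of a section `B` of `T*S ⊗ u*TM`, a section of `u*TM`:
`(div B)ᵃ = ∑ g^{ij} (∇ᵢ B)ᵃⱼ`. -/
def divergence (u : S → M)
    (B : ∀ x : S, TangentSpace (𝓡 n) x →ₗ[ℝ] TangentSpace (𝓡 m) (u x)) (p : S) :
    TangentSpace (𝓡 m) (u p) :=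
  ∑ a, (∑ i, ∑ j, (metricMatrix p (extChartAt (𝓡 n) p p))⁻¹ i j * covDerivCoord u B p i a j) •
    coordVec (u p) (u p) a

/-- The differential of `u` at `x`. -/
def differential (u : S → M) (x : S) :
    TangentSpace (𝓡 n) x →ₗ[ℝ] TangentSpace (𝓡 m) (u x) :=
  (mfderiv (𝓡 n) (𝓡 m) u x).toLinearMap

/-- A smooth map `u` is `q`-harmonic when `div (|du|^(q-2) du) = 0`; the section
`|du|^(q-2) du` is required to be `C¹`, so that its divergence makes sense. -/
def IsPHarmonic (q : ℕ) (u : S → M) : Prop :=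
  ContMDiff (𝓡 n) (𝓡 m) ∞ u ∧
    IsC1Section u (fun x => scaledMap (V := TangentSpace (𝓡 n) x)
      (W := TangentSpace (𝓡 m) (u x)) q (differential u x)) ∧
    ∀ x, divergence u (fun x => scaledMap (V := TangentSpace (𝓡 n) x)
      (W := TangentSpace (𝓡 m) (u x)) q (differential u x)) x = 0

end Maps

section Smith

variable {k m : ℕ}
  {S : Type*} [TopologicalSpace S] [ChartedSpace (Euc (k + 1)) S] [IsManifold (𝓡 (k + 1)) ∞ S]
  [RiemannianBundle (fun x : S => TangentSpace (𝓡 (k + 1)) x)]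
  {M : Type*} [TopologicalSpace M] [ChartedSpace (Euc m) M] [IsManifold (𝓡 m) ∞ M]
  [RiemannianBundle (fun y : M => TangentSpace (𝓡 m) y)]

/-- A map `u` from an oriented Riemannian `(k+1)`-manifold to a Riemannian manifold with a `k`-fold
vector cross product `Q` is a (smooth) Smith map when it is smooth and every `(du)_x` is a Smith
map for the Hodge star and `Q`. -/
def IsSmithMap (o : ∀ x : S, Orientation ℝ (TangentSpace (𝓡 (k + 1)) x) (Fin (k + 1)))
    (Q : ∀ y : M, VectorCrossProduct k (TangentSpace (𝓡 m) y)) (u : S → M) : Prop :=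
  ContMDiff (𝓡 (k + 1)) (𝓡 m) ∞ u ∧
    ∀ x, IsLinearSmithMap (hodgeStar (o x)) (Q (u x)).toAlt.toAlternatingMap (differential u x)

/-- The section `Q (Λᵏ du) ∗` of `T*S ⊗ u*TM`. -/
def crossStarSection (o : ∀ x : S, Orientation ℝ (TangentSpace (𝓡 (k + 1)) x) (Fin (k + 1)))
    (Q : ∀ y : M, VectorCrossProduct k (TangentSpace (𝓡 m) y)) (u : S → M) (x : S) :
    TangentSpace (𝓡 (k + 1)) x →ₗ[ℝ] TangentSpace (𝓡 m) (u x) :=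
  crossStar (o x) (Q (u x)).toAlt.toAlternatingMap (differential u x)

end Smith

end

/-! Write `n = k + 1`. Evaluating the Smith equation on `∗w` and using `∗∗ = (-1)^k` gives `Q(Λᵏ
du)∗ = (-1)^k λ^(k-1) du` (`crossStar_eq_smul`). The axioms of a cross product force `du` to be
conformal, with a factor `μ` that is either zero or satisfies `μ^(k-1) = λ^(k-1)`
(`exists_conformal_of_smith`). As `|du| = √(k+1) μ`, the section `|du|^(k-1) du` is a constant
multiple of `Q(Λᵏ du)∗` (`scaledMap_eq_smul_crossStar`), so its regularity and its divergence are
read off from the latter. That section is smooth because it is expressed through `Q`, the metric,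
the volume density and the derivatives of `u`; the function `λ` is never differentiated.

For the divergence, lower the target index in a chart. For each `a`, the resulting one-form on the
domain is, up to sign, the Hodge dual of `u*(ι_{∂ₐ} α)`. Its divergence is therefore governed by `d
u*(ι_{∂ₐ} α) = u* d(ι_{∂ₐ} α)`, and Cartan's formula with `dα = 0` turns this into the derivative
along `∂ₐ` of the coefficients of `α`, evaluated on the frozen vectors `∂ᵢu`
(`sum_partialDeriv_crossStarDensity`). Since the section is proportional to `du` at the point, the
connection of the target contributes only `g^{ij} ∂ₐh_{bc} ∂ᵢuᵇ ∂ⱼuᶜ`, up to a factor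
(`sum_inv_mul_covDeriv_eq_zero`).

The two contributions cancel by a first variation argument. For fixed coordinate vectors,
`(k+1)^(k+1) α(a₀, …, aₖ)² ≤ (∑ |aₗ|²)^(k+1)` holds at every base point
(`VectorCrossProduct.inner_sq_le`), with equality where the `aₗ` are the images of an orthonormal
basis under a Smith map. There the derivatives of the two sides in the base point agree, which
relates `∂ₐα` to `∂ₐh` (`partialDeriv_calibrationCoord`). No covariant derivative of `Q` is needed.
Where `du = 0`, both contributions vanish trivially. -/

section LinearAlgebra

/-! ### The arithmetic–geometric mean bound for the calibration form -/

theorem prod_le_mean_pow {n : ℕ} (hn : n ≠ 0) (x : Fin n → ℝ) (hx : ∀ i, 0 ≤ x i) :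
    (n : ℝ) ^ n * ∏ i, x i ≤ (∑ i, x i) ^ n := by
  have hn' : (n : ℝ) ≠ 0 := Nat.cast_ne_zero.2 hn
  have h := Real.geom_mean_le_arith_mean_weighted Finset.univ (fun _ : Fin n => (n : ℝ)⁻¹) x
    (fun _ _ => by positivity) (by simp [hn']) (fun i _ => hx i)
  rw [Real.finsetProd_rpow _ _ (fun i _ => hx i), ← Finset.mul_sum] at h
  have h0 : 0 ≤ ∏ i, x i := Finset.prod_nonneg fun i _ => hx i
  have h1 := pow_le_pow_left₀ (Real.rpow_nonneg h0 _) h n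
  rw [Real.rpow_inv_natCast_pow h0 hn, mul_pow, inv_pow] at h1
  rwa [inv_mul_eq_div, le_div_iff₀' (by positivity)] at h1

variable {V : Type*} [NormedAddCommGroup V] [InnerProductSpace ℝ V]
  {W : Type*} [NormedAddCommGroup W] [InnerProductSpace ℝ W]

/-- The bound `|α (a₀, …, aₖ)|² ≤ (|a|² / (k + 1)) ^ (k + 1)` for a calibration form. -/
theorem VectorCrossProduct.inner_sq_le {k : ℕ} (P : VectorCrossProduct k W) (a : Fin (k + 1) → W) :
    ((k + 1 : ℕ) : ℝ) ^ (k + 1) * P.calibrationForm a ^ 2 ≤ (∑ l, ‖a l‖ ^ 2) ^ (k + 1) := by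
  -- The eigenvalues of the Gram matrix have product `|P(a₀, …)|²` and sum `∑ |aᵢ|²` over the first
  -- `k` vectors. The mean inequality is applied to them together with `|aₖ|²`, after
  -- Cauchy–Schwarz.
  have hps := Matrix.posSemidef_gram ℝ (Fin.init a : Fin k → W)
  have hP : ‖P.toAlt (Fin.init a)‖ ^ 2 = ∏ i, hps.isHermitian.eigenvalues i := by
    rw [P.norm_sq]
    exact hps.isHermitian.det_eq_prod_eigenvalues
  have htr : ∑ i : Fin k, ‖a i.castSucc‖ ^ 2 = ∑ i, hps.isHermitian.eigenvalues i := by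
    have := hps.isHermitian.trace_eq_sum_eigenvalues
    simp only [RCLike.ofReal_real_eq_id, id] at this
    rw [← this, Matrix.trace]
    refine Finset.sum_congr rfl fun i _ => ?_
    rw [Matrix.diag_apply, Matrix.gram_apply, real_inner_self_eq_norm_sq]
    rfl
  have key := prod_le_mean_pow k.succ_ne_zero
    (Fin.snoc hps.isHermitian.eigenvalues (‖a (Fin.last k)‖ ^ 2) : Fin (k + 1) → ℝ) (by
      intro i
      induction i using Fin.lastCases with
      | last => simp
      | cast j => simpa using hps.eigenvalues_nonneg j)
  rw [Fin.prod_univ_castSucc, Fin.sum_univ_castSucc] at key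
  simp only [Fin.snoc_castSucc, Fin.snoc_last, ← hP, ← htr] at key
  rw [Fin.sum_univ_castSucc]
  refine le_trans ?_ key
  gcongr
  rw [← mul_pow]
  exact sq_le_sq' (by
    have := abs_le.1 (abs_real_inner_le_norm (P.toAlt (Fin.init a)) (a (Fin.last k)))
    exact this.1) (real_inner_le_norm _ _)

/-! ### Alternating maps and the Hodge star -/

/-- An injective selection of basis vectors is a permutation of the basis, so a form of top degree
is determined by one value. Identities of top degree need checking on a single orthonormal basis
only. -/
theorem AlternatingMap.eq_of_apply_basis_eq {ι R M N : Type*} [Fintype ι] [CommRing R]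
    [AddCommGroup M] [Module R M] [AddCommGroup N] [Module R N] (e : Module.Basis ι R M)
    {f g : M [⋀^ι]→ₗ[R] N} (h : f e = g e) : f = g := by
  classical
  refine e.ext_alternating fun σ hσ => ?_
  let τ : Equiv.Perm ι := Equiv.ofBijective σ (Finite.injective_iff_bijective.1 hσ)
  have h1 := f.map_perm e τ
  rw [h, ← g.map_perm e τ] at h1
  exact h1

theorem AlternatingMap.map_snoc {n : ℕ} {N : Type*} [AddCommGroup N] [Module ℝ N]
    (f : V [⋀^Fin (n + 1)]→ₗ[ℝ] N) (v : Fin n → V) (x : V) :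
    f (Fin.snoc v x : Fin (n + 1) → V) = (-1 : ℤ) ^ n • f (Matrix.vecCons x v) := by
  rw [← Fin.insertNth_last']
  simpa using f.map_insertNth (Fin.last n) x v

theorem AlternatingMap.map_vecCons_removeNth {n : ℕ} {N : Type*} [AddCommGroup N] [Module ℝ N]
    (f : V [⋀^Fin (n + 1)]→ₗ[ℝ] N) (v : Fin (n + 1) → V) (i : Fin (n + 1)) :
    f (Matrix.vecCons (v i) (i.removeNth v)) = (-1 : ℤ) ^ (i : ℕ) • f v := by
  rw [← f.neg_one_pow_smul_map_insertNth i (v i) (i.removeNth v)]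
  simp

theorem AlternatingMap.map_vecCons_removeNth_of_ne {n : ℕ} {N : Type*} [AddCommGroup N]
    [Module ℝ N] (f : V [⋀^Fin (n + 1)]→ₗ[ℝ] N) (v : Fin (n + 1) → V) {i j : Fin (n + 1)}
    (h : j ≠ i) : f (Matrix.vecCons (v j) (i.removeNth v)) = 0 := by
  obtain ⟨r, rfl⟩ := Fin.exists_succAbove_eq h
  exact f.map_eq_zero_of_eq _ (i := 0) (j := r.succ) (by simp [Fin.removeNth]) (Fin.succ_ne_zero r).symm

section Hodge

variable {N : Type*} [AddCommGroup N] [Module ℝ N] {k : ℕ}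

/-- Only injective `I` that avoid `i` contribute, and these are `i.succAbove ∘ σ` for permutations
`σ`. The sign of `σ` occurs in both factors and cancels. The `k!` equal terms absorb the
normalisation in `hodgeStarVec`. -/
theorem sum_det_smul (e : OrthonormalBasis (Fin (k + 1)) ℝ V) (η : V [⋀^Fin k]→ₗ[ℝ] N)
    (i : Fin (k + 1)) :
    ∑ I : Fin k → Fin (k + 1), e.toBasis.det (Matrix.vecCons (e i) (e ∘ I)) • η (e ∘ I) =
      (k.factorial : ℝ) • ((-1 : ℤ) ^ (i : ℕ) • η (i.removeNth e)) := by
  have hinj : Function.Injective (fun σ : Equiv.Perm (Fin k) => i.succAbove ∘ σ) := by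
    intro σ τ h
    ext r
    exact congrArg Fin.val (i.succAbove_right_injective (congrFun h r))
  rw [← Finset.sum_subset (Finset.subset_univ (Finset.univ.image
    (fun σ : Equiv.Perm (Fin k) => i.succAbove ∘ σ))), Finset.sum_image hinj.injOn]
  · have hterm : ∀ σ : Equiv.Perm (Fin k),
        e.toBasis.det (Matrix.vecCons (e i) (e ∘ (i.succAbove ∘ σ))) • η (e ∘ (i.succAbove ∘ σ)) =
          (-1 : ℤ) ^ (i : ℕ) • η (i.removeNth e) := by
      intro σ
      have h1 : e.toBasis.det (Matrix.vecCons (e i) (e ∘ (i.succAbove ∘ σ))) =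
          Equiv.Perm.sign σ • (-1) ^ (i : ℕ) := by
        have := (e.toBasis.det.curryLeft (e i)).map_perm (i.removeNth e) σ
        rw [AlternatingMap.curryLeft_apply_apply, AlternatingMap.curryLeft_apply_apply,
          AlternatingMap.map_vecCons_removeNth] at this
        have h2 : e.toBasis.det e = 1 := by
          conv_lhs => rw [← e.coe_toBasis]
          exact e.toBasis.det_self
        rw [h2] at this
        have h5 : e ∘ (i.succAbove ∘ σ) = (i.removeNth e) ∘ σ := rfl
        rw [h5]
        simpa using this
      have h3 := η.map_perm (i.removeNth e) σ
      have h4 : e ∘ (i.succAbove ∘ σ) = (i.removeNth e) ∘ σ := rfl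
      rw [h1, h4, h3]
      rcases Int.units_eq_one_or (Equiv.Perm.sign σ) with h | h <;>
        rcases neg_one_pow_eq_or ℤ (i : ℕ) with h' | h' <;>
        rcases neg_one_pow_eq_or ℝ (i : ℕ) with h'' | h'' <;> simp [h, h', h'']
      -- The cases left assign different values to the integer and the real power of `-1`.
      all_goals
        exfalso
        have := congrArg (Int.cast : ℤ → ℝ) h'
        push_cast at this
        rw [h''] at this
        norm_num at this
    simp only [hterm, Finset.sum_const, Finset.card_univ, Fintype.card_perm, Fintype.card_fin]
    rw [← Nat.cast_smul_eq_nsmul ℝ]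
  · intro I _ hI
    by_cases hJ : Function.Injective I ∧ ∀ r, I r ≠ i
    · exfalso
      apply hI
      choose τ hτ using fun r => Fin.exists_succAbove_eq (hJ.2 r)
      have hτi : Function.Injective τ := fun r s h => hJ.1 (by rw [← hτ r, ← hτ s, h])
      refine Finset.mem_image.2 ⟨Equiv.ofBijective τ (Finite.injective_iff_bijective.1 hτi),
        Finset.mem_univ _, funext fun r => ?_⟩
      simpa using hτ r
    · rw [not_and_or] at hJ
      rcases hJ with hJ | hJ
      · rw [η.map_eq_zero_of_not_injective, smul_zero]
        intro h
        exact hJ (fun r s hrs => h (by simp [hrs]))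
      · push Not at hJ
        obtain ⟨r, hr⟩ := hJ
        rw [AlternatingMap.map_eq_zero_of_eq _ _ (i := 0) (j := r.succ) _ (Fin.succ_ne_zero r).symm,
          zero_smul]
        simp [hr]

variable [Fact (Module.finrank ℝ V = k + 1)] (o : Orientation ℝ V (Fin (k + 1)))

theorem volumeForm_sq_of_orthonormal (e : OrthonormalBasis (Fin (k + 1)) ℝ V) :
    o.volumeForm e * o.volumeForm e = 1 := by
  rw [← abs_mul_abs_self, o.abs_volumeForm_apply_of_orthonormal e, one_mul]

theorem volumeForm_mul_volumeForm (e : OrthonormalBasis (Fin (k + 1)) ℝ V)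
    (v : Fin (k + 1) → V) : o.volumeForm e * o.volumeForm v = e.toBasis.det v := by
  have h1 := congrFun (congrArg DFunLike.coe (o.volumeForm.eq_smul_basis_det e.toBasis)) v
  simp only [AlternatingMap.smul_apply, OrthonormalBasis.coe_toBasis, smul_eq_mul] at h1
  rw [h1, ← mul_assoc, ← sq, ← sq_abs, o.abs_volumeForm_apply_of_orthonormal e]
  simp

variable [FiniteDimensional ℝ V]

theorem inner_hodgeStar (v : Fin k → V) (x : V) :
    ⟪hodgeStar o v, x⟫ = o.volumeForm (Fin.snoc v x : Fin (k + 1) → V) := by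
  have hL : ∀ y : V, o.volumeForm (Fin.snoc v y : Fin (k + 1) → V) =
      o.volumeForm.toMultilinearMap.toLinearMap (Fin.snoc v 0 : Fin (k + 1) → V) (Fin.last k) y := by
    intro y
    rw [MultilinearMap.toLinearMap_apply, Fin.update_snoc_last]
    rfl
  conv_rhs => rw [← (stdOrthonormalBasis ℝ V).sum_repr' x]
  rw [hL, map_sum]
  simp only [map_smul _ (⟪stdOrthonormalBasis ℝ V _, x⟫), ← hL]
  simp only [hodgeStar, AlternatingMap.coe_mk, MultilinearMap.coe_mk, sum_inner, inner_smul_left,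
    smul_eq_mul, RCLike.conj_to_real]
  exact Finset.sum_congr rfl fun l _ => mul_comm _ _

/-- Bringing the last slot to the front costs `(-1)^k`, and restoring `e i` to its place costs
`(-1)^i`. The basis need not be oriented, which accounts for the factor `o.volumeForm e = ±1`. -/
theorem hodgeStar_removeNth (e : OrthonormalBasis (Fin (k + 1)) ℝ V) (i : Fin (k + 1)) :
    hodgeStar o (i.removeNth e) = ((-1) ^ k * (-1) ^ (i : ℕ) * o.volumeForm e) • e i := by
  refine InnerProductSpace.ext_inner_right_basis e.toBasis fun j => ?_
  rw [inner_hodgeStar, AlternatingMap.map_snoc, inner_smul_left]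
  simp only [OrthonormalBasis.coe_toBasis]
  by_cases h : j = i
  · subst h
    rw [AlternatingMap.map_vecCons_removeNth]
    simp
    ring
  · rw [AlternatingMap.map_vecCons_removeNth_of_ne _ _ h]
    simp [e.inner_eq_zero (Ne.symm h)]

/-- The value `η (∗w)` of an alternating map on the Hodge star of a vector. -/
theorem volumeForm_smul_alternatingMap_hodgeStarVec (η : V [⋀^Fin k]→ₗ[ℝ] N) (w : V)
    (v : Fin (k + 1) → V) :
    o.volumeForm v • exteriorPower.alternatingMapLinearEquiv η (hodgeStarVec o w) =
      ∑ i : Fin (k + 1), (-1 : ℤ) ^ (i : ℕ) • ⟪w, v i⟫ • η (i.removeNth v) := by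
  have hfr : Module.finrank ℝ V = k + 1 := Fact.out
  let e : OrthonormalBasis (Fin (k + 1)) ℝ V := (stdOrthonormalBasis ℝ V).reindex (finCongr hfr)
  -- The alternatization of `F` is `w♭ ∧ η`, so the claim reads `w♭ ∧ η = η(∗w) vol`. Both sides
  -- have top degree, and it suffices to compare them on `e`.
  let F : V →ₗ[ℝ] V [⋀^Fin k]→ₗ[ℝ] N := (innerₛₗ ℝ w).smulRight η
  let ζ := exteriorPower.alternatingMapLinearEquiv η (hodgeStarVec o w)
  have hbase : o.volumeForm e • ζ = AlternatingMap.alternatizeUncurryFin F e := by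
    have hsum : ζ = (k.factorial : ℝ)⁻¹ • ∑ I : Fin k → Fin (k + 1),
        o.volumeForm (Matrix.vecCons w (e ∘ I)) • η (e ∘ I) := by
      simp only [ζ, hodgeStarVec, LinearMap.coe_mk, AddHom.coe_mk, map_smul, map_sum,
        exteriorPower.alternatingMapLinearEquiv_apply_ιMulti]
      congr 1
      refine Fintype.sum_equiv ((Equiv.refl (Fin k)).arrowCongr (finCongr hfr)) _ _ fun I => ?_
      have hI : (e ∘ ((Equiv.refl (Fin k)).arrowCongr (finCongr hfr)) I) =
          fun r => stdOrthonormalBasis ℝ V (I r) := by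
        funext r
        simp [e]
      rw [hI]
      rfl
    have hw : ∀ I : Fin k → Fin (k + 1), e.toBasis.det (Matrix.vecCons w (e ∘ I)) =
        ∑ i, ⟪e i, w⟫ * e.toBasis.det (Matrix.vecCons (e i) (e ∘ I)) := by
      intro I
      have : ∀ x, e.toBasis.det (Matrix.vecCons x (e ∘ I)) = e.toBasis.det.curryLeft x (e ∘ I) :=
        fun x => rfl
      simp only [this]
      have hadd : ∀ (s : Finset (Fin (k + 1))) (x : Fin (k + 1) → V),
          e.toBasis.det.curryLeft (∑ i ∈ s, x i) (e ∘ I) =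
            ∑ i ∈ s, e.toBasis.det.curryLeft (x i) (e ∘ I) := fun s x =>
        map_sum (G := V →+ ℝ) { toFun := fun y => e.toBasis.det.curryLeft y (e ∘ I)
                                map_zero' := by simp only [map_zero, AlternatingMap.zero_apply]
                                map_add' := fun a b => by
                                  simp only [map_add, AlternatingMap.add_apply] } x s
      conv_lhs => rw [← e.sum_repr' w, hadd]
      refine Finset.sum_congr rfl fun i _ => ?_
      rw [map_smul, AlternatingMap.smul_apply, smul_eq_mul]
    rw [hsum, smul_comm, Finset.smul_sum]
    simp only [smul_smul, volumeForm_mul_volumeForm, hw, Finset.sum_smul]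
    rw [Finset.sum_comm]
    simp only [← smul_smul, ← Finset.smul_sum]
    simp only [sum_det_smul, AlternatingMap.alternatizeUncurryFin_apply]
    rw [Finset.smul_sum]
    refine Finset.sum_congr rfl fun i _ => ?_
    have hk : (k.factorial : ℝ) ≠ 0 := by positivity
    rw [smul_comm ⟪e i, w⟫, inv_smul_smul₀ hk, smul_comm, real_inner_comm]
    rfl
  have hall : (o.volumeForm.smulRight ζ : V [⋀^Fin (k+1)]→ₗ[ℝ] N) =
      AlternatingMap.alternatizeUncurryFin F :=
    AlternatingMap.eq_of_apply_basis_eq e.toBasis (by simpa using hbase)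
  have := congrFun (congrArg DFunLike.coe hall) v
  rw [AlternatingMap.alternatizeUncurryFin_apply] at this
  exact this

theorem exists_orthonormalBasis_hilbertSchmidtNorm : ∃ e : OrthonormalBasis (Fin (k + 1)) ℝ V,
    ∀ A : V →ₗ[ℝ] W, hilbertSchmidtNorm A = √(∑ l, ‖A (e l)‖ ^ 2) := by
  have hfr : Module.finrank ℝ V = k + 1 := Fact.out
  refine ⟨(stdOrthonormalBasis ℝ V).reindex (finCongr hfr), fun A => ?_⟩
  rw [hilbertSchmidtNorm]
  congr 1
  exact Fintype.sum_equiv (finCongr hfr) _ _ fun i => by simp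

theorem alternatingMap_hodgeStar_hodgeStarVec (w : V) :
    exteriorPower.alternatingMapLinearEquiv (hodgeStar o) (hodgeStarVec o w) =
      ((-1) ^ k : ℝ) • w := by
  obtain ⟨e, -⟩ := exists_orthonormalBasis_hilbertSchmidtNorm (V := V) (W := V) (k := k)
  have h := volumeForm_smul_alternatingMap_hodgeStarVec o (hodgeStar o) w e
  have h2 := congrArg (fun x => o.volumeForm e • x) h
  simp only [smul_smul, volumeForm_sq_of_orthonormal, one_smul] at h2
  rw [h2, Finset.smul_sum]
  conv_rhs => rw [← e.sum_repr' w, Finset.smul_sum]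
  refine Finset.sum_congr rfl fun i _ => ?_
  rw [hodgeStar_removeNth, ← Int.cast_smul_eq_zsmul ℝ]
  simp only [smul_smul]
  congr 1
  have h3 := volumeForm_sq_of_orthonormal o e
  have h4 : ((-1 : ℝ) ^ (i : ℕ)) * (-1) ^ (i : ℕ) = 1 := by
    rw [← mul_pow]; simp
  push_cast
  rw [real_inner_comm]
  linear_combination ⟪e i, w⟫ * (-1) ^ k * (o.volumeForm e * o.volumeForm e * h4 + h3)

/-! ### Linear Smith maps -/

section Smith

variable {Q : VectorCrossProduct k W} {A : V →ₗ[ℝ] W} {c : ℝ}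

/-- The Smith equation is evaluated on `∗w`, where `∗∗w = (-1)^k w`. -/
theorem crossStar_eq_smul {P : W [⋀^Fin k]→ₗ[ℝ] W}
    (h : exteriorPower.alternatingMapLinearEquiv P ∘ₗ exteriorPower.map k A =
      c ^ (k - 1) • (A ∘ₗ exteriorPower.alternatingMapLinearEquiv (hodgeStar o))) :
    crossStar o P A = ((-1) ^ k * c ^ (k - 1)) • A := by
  ext w
  have := congrFun (congrArg DFunLike.coe h) (hodgeStarVec o w)
  simp only [LinearMap.comp_apply, LinearMap.smul_apply,
    alternatingMap_hodgeStar_hodgeStarVec, map_smul] at this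
  simp only [crossStar, LinearMap.comp_apply, LinearMap.smul_apply, this, smul_smul]
  rw [mul_comm]

theorem apply_of_smith {P : W [⋀^Fin k]→ₗ[ℝ] W}
    (h : exteriorPower.alternatingMapLinearEquiv P ∘ₗ exteriorPower.map k A =
      c ^ (k - 1) • (A ∘ₗ exteriorPower.alternatingMapLinearEquiv (hodgeStar o)))
    (v : Fin k → V) : P (A ∘ v) = c ^ (k - 1) • A (hodgeStar o v) := by
  have := congrFun (congrArg DFunLike.coe h) (exteriorPower.ιMulti ℝ k v)
  simpa [exteriorPower.map_apply_ιMulti, exteriorPower.alternatingMapLinearEquiv_apply_ιMulti]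
    using this

/-- A linear Smith map is conformal, and either vanishes or has conformal factor given by the
Smith equation. -/
theorem exists_conformal_of_smith (hc : 0 < c)
    (h : exteriorPower.alternatingMapLinearEquiv Q.toAlt.toAlternatingMap ∘ₗ
        exteriorPower.map k A =
      c ^ (k - 1) • (A ∘ₗ exteriorPower.alternatingMapLinearEquiv (hodgeStar o)))
    (e : OrthonormalBasis (Fin (k + 1)) ℝ V) :
    ∃ μ : ℝ, 0 ≤ μ ∧ (∀ i, ‖A (e i)‖ = μ) ∧ (μ = 0 ∨ μ ^ (k - 1) = c ^ (k - 1)) ∧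
      Q.calibrationForm (A ∘ e) = o.volumeForm e * c ^ (k - 1) * μ ^ 2 := by
  -- The star of the basis with `e i` omitted is `± e i`. By the Smith equation `A (e i)` is thus a
  -- multiple of the cross product of the other images: orthogonality of `Q` makes the images
  -- orthogonal, and the norm axiom relates their lengths.
  have hQ : ∀ i : Fin (k + 1), Q.toAlt (A ∘ i.removeNth e) =
      (c ^ (k - 1) * ((-1) ^ k * (-1) ^ (i : ℕ) * o.volumeForm e)) • A (e i) := by
    intro i
    have := apply_of_smith o h (i.removeNth e)
    rw [hodgeStar_removeNth, map_smul, smul_smul] at this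
    exact this
  have hc' : 0 < c ^ (k - 1) := pow_pos hc _
  have hv := volumeForm_sq_of_orthonormal o e
  have hv0 : o.volumeForm e ≠ 0 := fun h0 => by simp [h0] at hv
  have horth : ∀ i j, i ≠ j → ⟪A (e i), A (e j)⟫ = 0 := by
    intro i j hij
    obtain ⟨r, rfl⟩ := Fin.exists_succAbove_eq hij.symm
    have h1 := Q.orthogonal (A ∘ i.removeNth e) r
    rw [hQ, inner_smul_left] at h1
    refine (mul_eq_zero.1 h1).resolve_left ?_
    simp only [conj_trivial]
    exact mul_ne_zero hc'.ne' (mul_ne_zero (mul_ne_zero (pow_ne_zero _ (by norm_num))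
      (pow_ne_zero _ (by norm_num))) hv0)
  have hnorm : ∀ i, (c ^ (k - 1)) ^ 2 * ‖A (e i)‖ ^ 2 =
      ∏ r : Fin k, ‖A (e (i.succAbove r))‖ ^ 2 := by
    intro i
    have h1 := Q.norm_sq (A ∘ i.removeNth e)
    rw [hQ, norm_smul, mul_pow, Real.norm_eq_abs, sq_abs] at h1
    have h2 : (Matrix.of fun r s : Fin k => ⟪(A ∘ i.removeNth e) r, (A ∘ i.removeNth e) s⟫) =
        Matrix.diagonal fun r => ‖A (e (i.succAbove r))‖ ^ 2 := by
      ext r s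
      by_cases hrs : r = s
      · subst hrs
        simp [Fin.removeNth]
      · rw [Matrix.diagonal_apply_ne _ hrs]
        exact horth _ _ (fun h => hrs (i.succAbove_right_injective h))
    rw [h2, Matrix.det_diagonal] at h1
    rw [← h1]
    congr 1
    rw [mul_pow, mul_pow, mul_pow, ← pow_mul (-1 : ℝ), ← pow_mul (-1 : ℝ), mul_comm k 2,
      mul_comm (i : ℕ) 2, pow_mul, pow_mul, sq (o.volumeForm e), hv]
    norm_num
  -- Multiplying by `‖A (e i)‖²` makes the right side independent of `i`, so the lengths are
  -- compared without dividing by one that may vanish.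
  have hall : ∀ i, (c ^ (k - 1)) ^ 2 * (‖A (e i)‖ ^ 2) ^ 2 = ∏ j, ‖A (e j)‖ ^ 2 := by
    intro i
    rw [Fin.prod_univ_succAbove _ i, ← hnorm]
    ring
  have heq : ∀ i, ‖A (e i)‖ = ‖A (e 0)‖ := by
    intro i
    have h1 := (hall i).trans (hall 0).symm
    have h2 := mul_left_cancel₀ (by positivity) h1
    exact (pow_left_inj₀ (norm_nonneg _) (norm_nonneg _) two_ne_zero).1
      ((pow_left_inj₀ (by positivity) (by positivity) two_ne_zero).1 h2)
  refine ⟨‖A (e 0)‖, norm_nonneg _, heq, ?_, ?_⟩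
  · by_cases h0 : ‖A (e 0)‖ = 0
    · exact Or.inl h0
    right
    have h1 := hnorm 0
    simp only [heq, Finset.prod_const, Finset.card_univ, Fintype.card_fin] at h1
    have hk := Q.one_le
    have h2 : (‖A (e 0)‖ ^ 2) ^ k = (‖A (e 0)‖ ^ (k - 1)) ^ 2 * ‖A (e 0)‖ ^ 2 := by
      rw [← pow_mul, ← pow_mul, ← pow_add]
      congr 1
      omega
    rw [h2] at h1
    have h3 := mul_right_cancel₀ (pow_ne_zero 2 h0) h1
    exact ((pow_left_inj₀ (by positivity) (by positivity) two_ne_zero).1 h3).symm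
  · have h1 : Q.calibrationForm (A ∘ e) =
        ⟪Q.toAlt (A ∘ (Fin.last k).removeNth e), A (e (Fin.last k))⟫ := by
      rw [Fin.removeNth_last]
      rfl
    rw [h1, hQ, inner_smul_left, real_inner_self_eq_norm_sq, heq]
    simp only [conj_trivial, Fin.val_last]
    have h4 : ((-1 : ℝ) ^ k) * (-1) ^ k = 1 := by
      rw [← mul_pow]; simp
    rw [h4]
    ring

theorem scaledMap_eq_smul_crossStar
    (h : IsLinearSmithMap (hodgeStar o) Q.toAlt.toAlternatingMap A) :
    scaledMap (k + 1) A =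
      (√((k + 1 : ℕ) : ℝ) ^ (k - 1) * (-1) ^ k) • crossStar o Q.toAlt.toAlternatingMap A := by
  obtain ⟨c, hc, h⟩ := h
  obtain ⟨e, he⟩ := exists_orthonormalBasis_hilbertSchmidtNorm (V := V) (W := W) (k := k)
  obtain ⟨μ, hμ, hn, hμc, -⟩ := exists_conformal_of_smith o hc h e
  rw [crossStar_eq_smul o h, scaledMap, he]
  simp only [hn, Finset.sum_const, Finset.card_univ, Fintype.card_fin, nsmul_eq_mul]
  rw [Real.sqrt_mul (by positivity), Real.sqrt_sq hμ, show k + 1 - 2 = k - 1 by omega, smul_smul]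
  -- If `μ = 0` the powers of `μ` and `c` need not agree, but then `A = 0` and both sides vanish.
  rcases hμc with h0 | hμc
  · have hA : A = 0 := e.toBasis.ext fun i => by
      have := hn i
      rw [h0, norm_eq_zero] at this
      simpa using this
    simp [hA]
  · congr 1
    have h4 : ((-1 : ℝ) ^ k) * (-1) ^ k = 1 := by
      rw [← mul_pow]; simp
    rw [mul_pow, hμc]
    linear_combination (-√((k + 1 : ℕ) : ℝ) ^ (k - 1) * c ^ (k - 1)) * h4

end Smith

end Hodge

end LinearAlgebra

/-! ### Divergences in coordinates -/

section Calculus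

open Matrix

variable {n m : ℕ}

theorem partialDeriv_congr {i : Fin n} {f g : Euc n → ℝ} {z : Euc n} (h : f =ᶠ[𝓝 z] g) :
    partialDeriv i f z = partialDeriv i g z := by
  rw [partialDeriv, h.fderiv_eq, partialDeriv]

theorem partialDeriv_mul {i : Fin n} {f g : Euc n → ℝ} {z : Euc n} (hf : DifferentiableAt ℝ f z)
    (hg : DifferentiableAt ℝ g z) : partialDeriv i (fun z => f z * g z) z =
      partialDeriv i f z * g z + f z * partialDeriv i g z := by
  simp only [partialDeriv, fderiv_fun_mul hf hg]
  simp
  ring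

theorem partialDeriv_sum {ι : Type*} {i : Fin n} {s : Finset ι} {f : ι → Euc n → ℝ} {z : Euc n}
    (hf : ∀ l ∈ s, DifferentiableAt ℝ (f l) z) :
    partialDeriv i (fun z => ∑ l ∈ s, f l z) z = ∑ l ∈ s, partialDeriv i (f l) z := by
  simp only [partialDeriv, fderiv_fun_sum hf]
  simp

theorem partialDeriv_comp {i : Fin n} {f : Euc m → ℝ} {U : Euc n → Euc m} {z : Euc n}
    (hf : DifferentiableAt ℝ f (U z)) (hU : DifferentiableAt ℝ U z) :
    partialDeriv i (fun z => f (U z)) z =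
      ∑ b, partialDeriv b f (U z) * partialDeriv i (fun z => U z b) z := by
  have h1 : fderiv ℝ (fun z => f (U z)) z = (fderiv ℝ f (U z)).comp (fderiv ℝ U z) :=
    fderiv_comp z hf hU
  have h2 : ∀ b, partialDeriv i (fun z => U z b) z =
      fderiv ℝ U z (EuclideanSpace.single i 1) b := by
    intro b
    have : HasFDerivAt (fun z => U z b) ((EuclideanSpace.proj b).comp (fderiv ℝ U z)) z :=
      (EuclideanSpace.proj b : Euc m →L[ℝ] ℝ).hasFDerivAt.comp z hU.hasFDerivAt
    rw [partialDeriv, this.fderiv]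
    rfl
  simp only [h2]
  simp only [partialDeriv, h1, ContinuousLinearMap.comp_apply]
  conv_lhs => rw [← (EuclideanSpace.basisFun (Fin m) ℝ).sum_repr
    (fderiv ℝ U z (EuclideanSpace.single i 1))]
  simp [mul_comm]

/-- Jacobi's formula for the derivative of a determinant. -/
theorem partialDeriv_det {N : ℕ} {i : Fin n} {G : Euc n → Matrix (Fin N) (Fin N) ℝ} {z : Euc n}
    (hG : ∀ a b, DifferentiableAt ℝ (fun z => G z a b) z) (h0 : (G z).det ≠ 0) :
    DifferentiableAt ℝ (fun z => (G z).det) z ∧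
    partialDeriv i (fun z => (G z).det) z =
      (G z).det * ∑ a, ∑ b, (G z)⁻¹ b a * partialDeriv i (fun z => G z a b) z := by
  let Δ : ContinuousMultilinearMap ℝ (fun _ : Fin N => Fin N → ℝ) ℝ :=
    { (detRowAlternating : (Fin N → ℝ) [⋀^Fin N]→ₗ[ℝ] ℝ).toMultilinearMap with
      cont := by
        change Continuous fun M : Matrix (Fin N) (Fin N) ℝ => M.det
        fun_prop }
  have hG' : HasFDerivAt (fun z => (fun a b => G z a b : Fin N → Fin N → ℝ))
      (ContinuousLinearMap.pi fun a => ContinuousLinearMap.pi fun b =>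
        fderiv ℝ (fun z => G z a b) z) z :=
    hasFDerivAt_pi.2 fun a => hasFDerivAt_pi.2 fun b => (hG a b).hasFDerivAt
  have hΔ := (Δ.hasFDerivAt (fun a b => G z a b)).comp z hG'
  have hΔ' : HasFDerivAt (fun z => (G z).det) _ z := hΔ
  refine ⟨hΔ'.differentiableAt, ?_⟩
  rw [partialDeriv, hΔ'.fderiv]
  simp only [ContinuousLinearMap.comp_apply, ContinuousMultilinearMap.linearDeriv_apply]
  rw [Finset.mul_sum]
  -- The determinant is multilinear in the rows. The term of row `a` is the determinant with that
  -- row replaced by its derivative, which Cramer's rule expresses through the inverse matrix.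
  refine Finset.sum_congr rfl fun a _ => ?_
  set r : Fin N → ℝ := fun b => partialDeriv i (fun z => G z a b) z with hr
  have h1 : (Matrix.updateRow (G z) a r).det = (G z).det * ∑ b, (G z)⁻¹ b a * r b := by
    rw [← cramer_transpose_apply, cramer_eq_adjugate_mulVec, ← adjugate_transpose, mulVec,
      dotProduct, Finset.mul_sum]
    refine Finset.sum_congr rfl fun b _ => ?_
    rw [transpose_apply, inv_def, Matrix.smul_apply, smul_eq_mul, Ring.inverse_eq_inv', ← mul_assoc,
      ← mul_assoc, mul_inv_cancel₀ h0, one_mul]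
  rw [← h1]
  rfl

theorem sum_inv_mul_sum_mul {g : Matrix (Fin n) (Fin n) ℝ} (hg : g.det ≠ 0)
    (X : Fin n → Fin n → ℝ) :
    ∑ i, ∑ j, g⁻¹ i j * ∑ l, g j l * X i l = ∑ i, X i i := by
  refine Finset.sum_congr rfl fun i _ => ?_
  have : (g⁻¹ *ᵥ (g *ᵥ X i)) i = X i i := by
    rw [mulVec_mulVec, nonsing_inv_mul _ (isUnit_iff_ne_zero.2 hg), one_mulVec]
  exact this

theorem sum_inv_mulVec_mul_mulVec {g : Matrix (Fin n) (Fin n) ℝ} (hg : g.det ≠ 0)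
    (hs : g.IsSymm) (x y : Fin n → ℝ) :
    ∑ l, (∑ r, g⁻¹ l r * x r) * (∑ r, g l r * y r) = ∑ r, x r * y r := by
  have : (g⁻¹ *ᵥ x) ⬝ᵥ (g *ᵥ y) = x ⬝ᵥ y := by
    rw [dotProduct_mulVec, ← mulVec_transpose, hs.eq, mulVec_mulVec,
      mul_nonsing_inv _ (isUnit_iff_ne_zero.2 hg), one_mulVec]
  exact this

theorem sum_symm_mul_antisymm {g : Fin n → Fin n → ℝ} (hg : ∀ i j, g i j = g j i)
    {x : Fin n → Fin n → ℝ} (hx : ∀ i j, x i j = -x j i) : ∑ i, ∑ j, g i j * x i j = 0 := by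
  have : ∑ i, ∑ j, g i j * x i j = -∑ i, ∑ j, g i j * x i j := by
    conv_lhs => rw [Finset.sum_comm]
    simp only [← Finset.sum_neg_distrib]
    refine Finset.sum_congr rfl fun i _ => Finset.sum_congr rfl fun j _ => ?_
    rw [hg, hx]
    ring
  linarith

/-- The divergence `D⁻¹ ∑ ∂ᵢ Nⁱ` of a one-form `βⱼ = D⁻¹ ∑ gⱼᵢ Nⁱ`, where `D² = det g`. -/
theorem sum_inv_mul_covDeriv_oneForm {G : Euc n → Matrix (Fin n) (Fin n) ℝ} {z₀ : Euc n}
    (hG : ∀ a b, DifferentiableAt ℝ (fun z => G z a b) z₀) (hs : ∀ z, (G z).IsSymm)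
    {D : Euc n → ℝ} (hD : DifferentiableAt ℝ D z₀) (hD0 : D z₀ ≠ 0)
    (hDG : ∀ᶠ z in 𝓝 z₀, D z * D z = (G z).det)
    {N β : Fin n → Euc n → ℝ} (hN : ∀ i, DifferentiableAt ℝ (N i) z₀)
    (hβ : ∀ j, ∀ᶠ z in 𝓝 z₀, β j z = (D z)⁻¹ * ∑ l, G z j l * N l z) :
    ∑ i, ∑ j, (G z₀)⁻¹ i j * (partialDeriv i (β j) z₀ - ∑ l,
      ((1 / 2) * ∑ r, (G z₀)⁻¹ l r * (partialDeriv i (fun z => G z j r) z₀ +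
        partialDeriv j (fun z => G z i r) z₀ - partialDeriv r (fun z => G z i j) z₀)) * β l z₀) =
      (D z₀)⁻¹ * ∑ i, partialDeriv i (N i) z₀ := by
  have hdet : (G z₀).det ≠ 0 := by
    rw [← hDG.self_of_nhds]; exact mul_ne_zero hD0 hD0
  have hgi : ∀ i j, (G z₀)⁻¹ i j = (G z₀)⁻¹ j i := fun i j => by
    conv_lhs => rw [← (hs z₀).eq, ← transpose_nonsing_inv]
    rfl
  -- Differentiating `D² = det G` by Jacobi's formula leaves the sign of `D` free.
  have hDi : ∀ i, partialDeriv i D z₀ = (1 / 2) * D z₀ *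
      ∑ a, ∑ b, (G z₀)⁻¹ a b * partialDeriv i (fun z => G z a b) z₀ := by
    intro i
    have h1 : partialDeriv i (fun z => D z * D z) z₀ = _ :=
      (partialDeriv_congr hDG).trans (partialDeriv_det hG hdet).2
    rw [partialDeriv_mul hD hD, ← hDG.self_of_nhds] at h1
    simp only [hgi] at h1 ⊢
    refine mul_left_cancel₀ hD0 ?_
    linarith
  have hβi : ∀ i j, partialDeriv i (β j) z₀ = (D z₀)⁻¹ *
      (∑ l, partialDeriv i (fun z => G z j l) z₀ * N l z₀ + ∑ l, G z₀ j l *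
        (partialDeriv i (N l) z₀ - (D z₀)⁻¹ * partialDeriv i D z₀ * N l z₀)) := by
    intro i j
    have hprod : ∀ l, DifferentiableAt ℝ (fun z => G z j l * N l z) z₀ :=
      fun l => (hG j l).mul (hN l)
    have h1 : partialDeriv i (fun z => D z * β j z) z₀ =
        partialDeriv i (fun z => ∑ l, G z j l * N l z) z₀ := by
      refine partialDeriv_congr ?_
      filter_upwards [hβ j, hD.continuousAt.eventually_ne hD0] with z hz hz0
      rw [hz, mul_inv_cancel_left₀ hz0]
    have hβd : DifferentiableAt ℝ (β j) z₀ :=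
      ((hD.inv hD0).mul (DifferentiableAt.fun_sum fun l _ => hprod l)).congr_of_eventuallyEq (hβ j)
    rw [partialDeriv_mul hD hβd, partialDeriv_sum fun l _ => hprod l] at h1
    simp only [partialDeriv_mul (hG _ _) (hN _)] at h1
    rw [(hβ j).self_of_nhds, Finset.sum_add_distrib] at h1
    have h2 : ∑ l, G z₀ j l *
        (partialDeriv i (N l) z₀ - (D z₀)⁻¹ * partialDeriv i D z₀ * N l z₀) =
        ∑ l, G z₀ j l * partialDeriv i (N l) z₀ -
          (D z₀)⁻¹ * partialDeriv i D z₀ * ∑ l, G z₀ j l * N l z₀ := by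
      rw [Finset.mul_sum, ← Finset.sum_sub_distrib]
      exact Finset.sum_congr rfl fun l _ => by ring
    rw [h2, eq_inv_mul_iff_mul_eq₀ hD0]
    linear_combination h1
  have hΓ : ∀ i j, ∑ l, ((1 / 2) * ∑ r, (G z₀)⁻¹ l r * (partialDeriv i (fun z => G z j r) z₀ +
        partialDeriv j (fun z => G z i r) z₀ - partialDeriv r (fun z => G z i j) z₀)) * β l z₀ =
      (D z₀)⁻¹ * ∑ r, (1 / 2) * (partialDeriv i (fun z => G z j r) z₀ +
        partialDeriv j (fun z => G z i r) z₀ - partialDeriv r (fun z => G z i j) z₀) * N r z₀ := by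
    intro i j
    have h := sum_inv_mulVec_mul_mulVec hdet (hs z₀) (fun r => partialDeriv i (fun z => G z j r) z₀ +
        partialDeriv j (fun z => G z i r) z₀ - partialDeriv r (fun z => G z i j) z₀)
        (fun r => N r z₀)
    simp only [(hβ _).self_of_nhds]
    simp only [mul_assoc (1 / 2 : ℝ), ← Finset.mul_sum]
    rw [← h, mul_left_comm (D z₀)⁻¹, Finset.mul_sum Finset.univ _ (D z₀)⁻¹]
    congr 1
    refine Finset.sum_congr rfl fun l _ => ?_
    ring
  -- After summation the first part traces to `∂ᵢNⁱ - D⁻¹ ∂ᵢD Nⁱ`. The second is antisymmetric in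
  -- `i, j` and is killed by the symmetric `g^{ij}`. The third gives `D⁻¹ ∂ᵣD Nʳ` and cancels the
  -- correction in the first.
  have hterm : ∀ i j, (G z₀)⁻¹ i j * (partialDeriv i (β j) z₀ - ∑ l,
      ((1 / 2) * ∑ r, (G z₀)⁻¹ l r * (partialDeriv i (fun z => G z j r) z₀ +
        partialDeriv j (fun z => G z i r) z₀ - partialDeriv r (fun z => G z i j) z₀)) * β l z₀) =
      (D z₀)⁻¹ * ((G z₀)⁻¹ i j * ∑ l, G z₀ j l *
        (partialDeriv i (N l) z₀ - (D z₀)⁻¹ * partialDeriv i D z₀ * N l z₀) +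
      (G z₀)⁻¹ i j * ∑ r, (1 / 2) * (partialDeriv i (fun z => G z j r) z₀ -
        partialDeriv j (fun z => G z i r) z₀) * N r z₀ +
      ∑ r, (1 / 2) * ((G z₀)⁻¹ i j * partialDeriv r (fun z => G z i j) z₀) * N r z₀) := by
    intro i j
    rw [hΓ, hβi]
    have : ∑ r, (1 / 2) * (partialDeriv i (fun z => G z j r) z₀ +
        partialDeriv j (fun z => G z i r) z₀ - partialDeriv r (fun z => G z i j) z₀) * N r z₀ =
        ∑ l, partialDeriv i (fun z => G z j l) z₀ * N l z₀ -
        ∑ r, (1 / 2) * (partialDeriv i (fun z => G z j r) z₀ -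
        partialDeriv j (fun z => G z i r) z₀) * N r z₀ -
        ∑ r, (1 / 2) * partialDeriv r (fun z => G z i j) z₀ * N r z₀ := by
      rw [← Finset.sum_sub_distrib, ← Finset.sum_sub_distrib]
      exact Finset.sum_congr rfl fun l _ => by ring
    have h3 : ∑ r, (1 / 2) * ((G z₀)⁻¹ i j * partialDeriv r (fun z => G z i j) z₀) * N r z₀ =
        (G z₀)⁻¹ i j * ∑ r, (1 / 2) * partialDeriv r (fun z => G z i j) z₀ * N r z₀ := by
      rw [Finset.mul_sum]
      exact Finset.sum_congr rfl fun l _ => by ring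
    rw [this, h3]
    ring
  simp only [hterm, ← Finset.mul_sum, Finset.sum_add_distrib]
  congr 1
  rw [sum_inv_mul_sum_mul hdet fun i l =>
    partialDeriv i (N l) z₀ - (D z₀)⁻¹ * partialDeriv i D z₀ * N l z₀,
    sum_symm_mul_antisymm hgi (x := fun i j => ∑ r, (1 / 2) *
      (partialDeriv i (fun z => G z j r) z₀ - partialDeriv j (fun z => G z i r) z₀) * N r z₀)
    fun i j => by
      rw [← Finset.sum_neg_distrib]
      exact Finset.sum_congr rfl fun r _ => by ring,
    Finset.sum_sub_distrib]
  have hlast : ∑ i, ∑ j, ∑ r, (1 / 2) * ((G z₀)⁻¹ i j * partialDeriv r (fun z => G z i j) z₀) *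
      N r z₀ = ∑ r, (D z₀)⁻¹ * partialDeriv r D z₀ * N r z₀ := by
    have : ∀ r, (D z₀)⁻¹ * partialDeriv r D z₀ * N r z₀ =
        ∑ i, ∑ j, (1 / 2) * ((G z₀)⁻¹ i j * partialDeriv r (fun z => G z i j) z₀) * N r z₀ := by
      intro r
      rw [hDi]
      simp only [← Finset.mul_sum, ← Finset.sum_mul]
      field_simp
    simp only [this]
    rw [Finset.sum_comm]
    conv_rhs => rw [Finset.sum_comm]
    rw [Finset.sum_comm]
    refine Finset.sum_congr rfl fun i _ => ?_
    rw [Finset.sum_comm]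
  rw [hlast]
  ring

/-- The divergence, in coordinates, of a section `B` of `T*S ⊗ u*TM` whose value at a point is
proportional to `du`, and whose lowered components are `D⁻¹ ∑ gⱼᵢ Nⁱ`. -/
theorem sum_inv_mul_covDeriv_eq_zero {G : Euc n → Matrix (Fin n) (Fin n) ℝ} {z₀ : Euc n}
    (hG : ∀ a b, DifferentiableAt ℝ (fun z => G z a b) z₀) (hGs : ∀ z, (G z).IsSymm)
    {D : Euc n → ℝ} (hD : DifferentiableAt ℝ D z₀) (hD0 : D z₀ ≠ 0)
    (hDG : ∀ᶠ z in 𝓝 z₀, D z * D z = (G z).det)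
    {U : Euc n → Euc m} (hU : DifferentiableAt ℝ U z₀)
    {H : Euc m → Matrix (Fin m) (Fin m) ℝ}
    (hH : ∀ a b, DifferentiableAt ℝ (fun y => H y a b) (U z₀)) (hHs : ∀ y, (H y).IsSymm)
    (hH0 : (H (U z₀)).det ≠ 0)
    {B N : Fin m → Fin n → Euc n → ℝ} (hB : ∀ a j, DifferentiableAt ℝ (B a j) z₀)
    (hN : ∀ a j, DifferentiableAt ℝ (N a j) z₀)
    (hBN : ∀ a j, ∀ᶠ z in 𝓝 z₀, ∑ d, H (U z) a d * B d j z = (D z)⁻¹ * ∑ l, G z j l * N a l z)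
    {κ : ℝ} (hκ : ∀ a j, B a j z₀ = κ * partialDeriv j (fun z => U z a) z₀)
    (hdN : ∀ a, ∑ i, partialDeriv i (N a i) z₀ = (1 / 2) * κ * D z₀ * ∑ i, ∑ j, (G z₀)⁻¹ i j *
      ∑ b, ∑ c, partialDeriv a (fun y => H y b c) (U z₀) *
        partialDeriv i (fun z => U z b) z₀ * partialDeriv j (fun z => U z c) z₀) (a : Fin m) :
    ∑ i, ∑ j, (G z₀)⁻¹ i j * (partialDeriv i (B a j) z₀ -
      ∑ l, ((1 / 2) * ∑ r, (G z₀)⁻¹ l r * (partialDeriv i (fun z => G z j r) z₀ +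
        partialDeriv j (fun z => G z i r) z₀ - partialDeriv r (fun z => G z i j) z₀)) * B a l z₀ +
      ∑ b, ∑ c, ((1 / 2) * ∑ r, (H (U z₀))⁻¹ a r * (partialDeriv b (fun y => H y c r) (U z₀) +
        partialDeriv c (fun y => H y b r) (U z₀) - partialDeriv r (fun y => H y b c) (U z₀))) *
        partialDeriv i (fun z => U z b) z₀ * B c j z₀) = 0 := by
  have hgi : ∀ i j, (G z₀)⁻¹ i j = (G z₀)⁻¹ j i := fun i j => by
    conv_lhs => rw [← (hGs z₀).eq, ← transpose_nonsing_inv]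
    rfl
  have hHds : ∀ i a b, partialDeriv i (fun z => H z a b) (U z₀) =
      partialDeriv i (fun z => H z b a) (U z₀) := fun i a b =>
    partialDeriv_congr (Filter.Eventually.of_forall fun z => (hHs z).apply b a)
  set Γ : Fin n → Fin n → Fin n → ℝ := fun l i j =>
    (1 / 2) * ∑ r, (G z₀)⁻¹ l r * (partialDeriv i (fun z => G z j r) z₀ +
        partialDeriv j (fun z => G z i r) z₀ - partialDeriv r (fun z => G z i j) z₀) with hΓdef
  set δ : Fin m → Fin m → Fin m → ℝ := fun a b c => partialDeriv a (fun y => H y b c) (U z₀)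
    with hδ
  set w : Fin n → Fin m → ℝ := fun i b => partialDeriv i (fun z => U z b) z₀ with hw
  set T : Fin m → Fin n → Fin n → ℝ := fun d i j => partialDeriv i (B d j) z₀ -
      ∑ l, Γ l i j * B d l z₀ +
      ∑ b, ∑ c, ((1 / 2) * ∑ r, (H (U z₀))⁻¹ d r * (δ b c r + δ c b r - δ r b c)) *
        w i b * B c j z₀ with hT
  -- Lowering the target index produces the covariant derivative of a one-form on the domain plus
  -- terms in `∂h`. With `B = κ ∂u` at the point, these split into a part that changes sign when `i`
  -- and `j` are exchanged, which the trace removes, and the part in `δ a b c`, which `hdN` cancels.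
  have hlow : ∀ a i j, ∑ d, H (U z₀) a d * T d i j =
      (partialDeriv i (fun z => ∑ d, H (U z) a d * B d j z) z₀ -
        ∑ l, Γ l i j * ∑ d, H (U z₀) a d * B d l z₀) -
      (1 / 2) * κ * (∑ b, ∑ c, (δ b c a - δ c b a) * (w i b * w j c) +
        ∑ b, ∑ c, δ a b c * w i b * w j c) := by
    intro a i j
    have hHU : ∀ d, DifferentiableAt ℝ (fun z => H (U z) a d) z₀ :=
      fun d => (hH a d).comp z₀ hU
    have h1 : partialDeriv i (fun z => ∑ d, H (U z) a d * B d j z) z₀ =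
        ∑ d, ((∑ b, δ b a d * w i b) * B d j z₀ + H (U z₀) a d * partialDeriv i (B d j) z₀) := by
      refine (partialDeriv_sum (f := fun d z => H (U z) a d * B d j z)
        fun d _ => (hHU d).mul (hB d j)).trans ?_
      refine Finset.sum_congr rfl fun d _ => ?_
      rw [partialDeriv_mul (hHU d) (hB d j), partialDeriv_comp (hH a d) hU]
    have h2 : ∑ l, Γ l i j * ∑ d, H (U z₀) a d * B d l z₀ =
        ∑ d, H (U z₀) a d * ∑ l, Γ l i j * B d l z₀ := by
      simp only [Finset.mul_sum]
      rw [Finset.sum_comm]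
      exact Finset.sum_congr rfl fun d _ => Finset.sum_congr rfl fun l _ => by ring
    have h3 : ∑ d, H (U z₀) a d * ∑ b, ∑ c, ((1 / 2) * ∑ r, (H (U z₀))⁻¹ d r *
        (δ b c r + δ c b r - δ r b c)) * w i b * B c j z₀ =
        ∑ b, ∑ c, (1 / 2) * (δ b c a + δ c b a - δ a b c) * w i b * B c j z₀ := by
      simp only [Finset.mul_sum Finset.univ (fun b => ∑ c, _) (H (U z₀) a _)]
      rw [Finset.sum_comm]
      refine Finset.sum_congr rfl fun b _ => ?_
      simp only [Finset.mul_sum Finset.univ _ (H (U z₀) a _)]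
      rw [Finset.sum_comm]
      refine Finset.sum_congr rfl fun c _ => ?_
      have h4 : ∑ d, H (U z₀) a d * ∑ r, (H (U z₀))⁻¹ d r * (δ b c r + δ c b r - δ r b c) =
          δ b c a + δ c b a - δ a b c := by
        have : (H (U z₀) *ᵥ ((H (U z₀))⁻¹ *ᵥ fun r => δ b c r + δ c b r - δ r b c)) a =
            δ b c a + δ c b a - δ a b c := by
          rw [mulVec_mulVec, mul_nonsing_inv _ (isUnit_iff_ne_zero.2 hH0), one_mulVec]
        exact this
      rw [← h4, Finset.mul_sum, Finset.sum_mul, Finset.sum_mul]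
      exact Finset.sum_congr rfl fun d _ => by ring
    have h5 : ∑ d, (∑ b, δ b a d * w i b) * B d j z₀ = ∑ b, ∑ c, δ b c a * w i b * B c j z₀ := by
      simp only [Finset.sum_mul]
      rw [Finset.sum_comm]
      refine Finset.sum_congr rfl fun b _ => Finset.sum_congr rfl fun c _ => ?_
      simp only [hδ]
      rw [hHds]
    have h6 : ∑ b, ∑ c, (1 / 2) * (δ b c a + δ c b a - δ a b c) * w i b * B c j z₀ -
        ∑ b, ∑ c, δ b c a * w i b * B c j z₀ = - ((1 / 2) * κ *
        (∑ b, ∑ c, (δ b c a - δ c b a) * (w i b * w j c) + ∑ b, ∑ c, δ a b c * w i b * w j c)) := by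
      simp only [mul_add, Finset.mul_sum, ← Finset.sum_sub_distrib, ← Finset.sum_add_distrib,
        ← Finset.sum_neg_distrib]
      refine Finset.sum_congr rfl fun b _ => Finset.sum_congr rfl fun c _ => ?_
      rw [hκ]
      ring
    have h7 : ∑ d, H (U z₀) a d * T d i j = ∑ d, H (U z₀) a d * partialDeriv i (B d j) z₀ -
        ∑ d, H (U z₀) a d * ∑ l, Γ l i j * B d l z₀ +
        ∑ d, H (U z₀) a d * ∑ b, ∑ c, ((1 / 2) * ∑ r, (H (U z₀))⁻¹ d r *
        (δ b c r + δ c b r - δ r b c)) * w i b * B c j z₀ := by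
      rw [← Finset.sum_sub_distrib, ← Finset.sum_add_distrib]
      exact Finset.sum_congr rfl fun d _ => by
        simp only [hT]
        ring
    rw [h7, h3, ← h2, h1, Finset.sum_add_distrib, h5]
    linear_combination h6
  have hone := fun a => sum_inv_mul_covDeriv_oneForm hG hGs hD hD0 hDG (hN a)
    (β := fun j z => ∑ d, H (U z) a d * B d j z) (hBN a)
  have hzero : ∀ a, ∑ d, H (U z₀) a d * ∑ i, ∑ j, (G z₀)⁻¹ i j * T d i j = 0 := by
    intro a
    have h1 : ∑ d, H (U z₀) a d * ∑ i, ∑ j, (G z₀)⁻¹ i j * T d i j =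
        ∑ i, ∑ j, (G z₀)⁻¹ i j * ∑ d, H (U z₀) a d * T d i j := by
      simp only [Finset.mul_sum]
      rw [Finset.sum_comm]
      refine Finset.sum_congr rfl fun i _ => ?_
      rw [Finset.sum_comm]
      exact Finset.sum_congr rfl fun j _ => Finset.sum_congr rfl fun d _ => by ring
    have h2 := sum_symm_mul_antisymm hgi
      (x := fun i j => ∑ b, ∑ c, (δ b c a - δ c b a) * (w i b * w j c)) fun i j => by
        conv_lhs => rw [Finset.sum_comm]
        simp only [← Finset.sum_neg_distrib]
        exact Finset.sum_congr rfl fun b _ => Finset.sum_congr rfl fun c _ => by ring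
    have h3 := hone a
    rw [hdN a] at h3
    rw [h1]
    simp only [hlow]
    have h4 : ∀ i j, (G z₀)⁻¹ i j * ((partialDeriv i (fun z => ∑ d, H (U z) a d * B d j z) z₀ -
        ∑ l, Γ l i j * ∑ d, H (U z₀) a d * B d l z₀) -
      (1 / 2) * κ * (∑ b, ∑ c, (δ b c a - δ c b a) * (w i b * w j c) +
        ∑ b, ∑ c, δ a b c * w i b * w j c)) =
      (G z₀)⁻¹ i j * (partialDeriv i (fun z => ∑ d, H (U z) a d * B d j z) z₀ -
        ∑ l, Γ l i j * ∑ d, H (U z₀) a d * B d l z₀) -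
      (1 / 2) * κ * ((G z₀)⁻¹ i j * ∑ b, ∑ c, (δ b c a - δ c b a) * (w i b * w j c)) -
      (1 / 2) * κ * ((G z₀)⁻¹ i j * ∑ b, ∑ c, δ a b c * w i b * w j c) := fun i j => by ring
    simp only [h4, Finset.sum_sub_distrib, ← Finset.mul_sum]
    rw [h2, h3]
    field_simp
    ring
  have hfin : H (U z₀) *ᵥ (fun d => ∑ i, ∑ j, (G z₀)⁻¹ i j * T d i j) = 0 := funext hzero
  have := congrArg (fun v => (H (U z₀))⁻¹ *ᵥ v) hfin
  simp only [mulVec_mulVec, nonsing_inv_mul _ (isUnit_iff_ne_zero.2 hH0), one_mulVec,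
    mulVec_zero] at this
  exact congrFun this a

end Calculus

/-! ### Gram matrices and the volume form -/

section Gram

variable {V : Type*} [NormedAddCommGroup V] [InnerProductSpace ℝ V] {k : ℕ}

/-- Expanding `b i` in the orthonormal basis and reading off its coordinates in `b` shows that the
right side inverts the Gram matrix. It converts contractions with `g^{ij}` into sums over an
orthonormal basis. -/
theorem gram_inv_apply (e : OrthonormalBasis (Fin k) ℝ V) (b : Module.Basis (Fin k) ℝ V)
    (i j : Fin k) : (Matrix.of fun i j => ⟪b i, b j⟫)⁻¹ i j = ∑ l, b.repr (e l) i * b.repr (e l) j := by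
  have h : (Matrix.of fun i j => ⟪b i, b j⟫) *
      (Matrix.of fun i j => ∑ l, b.repr (e l) i * b.repr (e l) j) = 1 := by
    ext i j
    have h1 : ∀ l, ⟪b i, e l⟫ = ∑ r, b.repr (e l) r * ⟪b i, b r⟫ := fun l => by
      conv_lhs => rw [← b.sum_repr (e l), inner_sum]
      simp only [real_inner_smul_right]
    have h2 : b.repr (b i) j = ∑ l, ⟪b i, e l⟫ * b.repr (e l) j := by
      conv_lhs => rw [← e.sum_repr' (b i)]
      simp [real_inner_comm]
    rw [Matrix.mul_apply]
    simp only [Matrix.of_apply, Matrix.one_apply, Finset.mul_sum]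
    rw [Finset.sum_comm]
    simp only [h1, Finset.sum_mul] at h2
    rw [b.repr_self, Finsupp.single_apply] at h2
    rw [h2]
    exact Finset.sum_congr rfl fun l _ => Finset.sum_congr rfl fun r _ => by ring
  rw [Matrix.inv_eq_right_inv h, Matrix.of_apply]

variable [Fact (Module.finrank ℝ V = k + 1)] (o : Orientation ℝ V (Fin (k + 1)))

theorem volumeForm_mul_self (v : Fin (k + 1) → V) :
    o.volumeForm v * o.volumeForm v = (Matrix.of fun i j => ⟪v i, v j⟫).det := by
  have hfr : Module.finrank ℝ V = k + 1 := Fact.out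
  let e := o.finOrthonormalBasis k.succ_pos hfr
  have h1 : (Matrix.of fun i j => ⟪v i, v j⟫) =
      (e.toBasis.toMatrix v).transpose * e.toBasis.toMatrix v := by
    ext i j
    simp only [Matrix.of_apply, Matrix.mul_apply, Matrix.transpose_apply, Module.Basis.toMatrix_apply,
      OrthonormalBasis.coe_toBasis_repr_apply, OrthonormalBasis.repr_apply_apply]
    rw [← e.sum_inner_mul_inner (v i) (v j)]
    exact Finset.sum_congr rfl fun l _ => by rw [real_inner_comm]
  rw [h1, Matrix.det_mul, Matrix.det_transpose, o.volumeForm_robust e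
    (o.finOrthonormalBasis_orientation _ _), Module.Basis.det_apply]

theorem volumeForm_basis_pos_iff (b : Module.Basis (Fin (k + 1)) ℝ V) :
    0 < o.volumeForm b ↔ b.orientation = o := by
  have hfr : Module.finrank ℝ V = k + 1 := Fact.out
  let e := o.finOrthonormalBasis k.succ_pos hfr
  have he : e.toBasis.orientation = o := o.finOrthonormalBasis_orientation _ _
  rw [o.volumeForm_robust e he, ← Module.Basis.orientation_eq_iff_det_pos, he, eq_comm]

end Gram

/-! ### Coordinate frames and smoothness of the metric coefficients -/

section Frame

variable {n : ℕ} {M : Type*} [TopologicalSpace M] [ChartedSpace (Euc n) M]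
  [IsManifold (𝓡 n) ∞ M] {p x : M}

theorem coframe_frame (hx : x ∈ (extChartAt (𝓡 n) p).source) (v : Euc n) :
    coframe p x (frame p x v) = v :=
  (trivializationAt (Euc n) (fun y : M => TangentSpace (𝓡 n) y) p).continuousLinearMapAt_symmL
    (by simpa using hx) v

theorem frame_coframe (hx : x ∈ (extChartAt (𝓡 n) p).source) (v : TangentSpace (𝓡 n) x) :
    frame p x (coframe p x v) = v :=
  (trivializationAt (Euc n) (fun y : M => TangentSpace (𝓡 n) y) p).symmL_continuousLinearMapAt
    (by simpa using hx) v

theorem frame_apply (v : Euc n) : frame p x v = ∑ i, v i • coordVec p x i := by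
  conv_lhs => rw [← (EuclideanSpace.basisFun (Fin n) ℝ).sum_repr v]
  simp [coordVec]

theorem continuousLinearEquivAt_symm_apply (hx : x ∈ (extChartAt (𝓡 n) p).source) (v : Euc n) :
    ((trivializationAt (Euc n) (fun y : M => TangentSpace (𝓡 n) y) p).continuousLinearEquivAt ℝ x
      (by simpa using hx)).symm v = frame p x v := by
  exact congrFun (Trivialization.symm_continuousLinearEquivAt_eq (R := ℝ) _ _) v

/-- The coordinate frame at `x` of the chart around `p`, as a basis. -/
noncomputable def coordBasis (p : M) {x : M} (hx : x ∈ (extChartAt (𝓡 n) p).source) :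
    Module.Basis (Fin n) ℝ (TangentSpace (𝓡 n) x) :=
  (EuclideanSpace.basisFun (Fin n) ℝ).toBasis.map
    ((trivializationAt (Euc n) (fun y : M => TangentSpace (𝓡 n) y) p).continuousLinearEquivAt ℝ x
      (by simpa using hx)).symm.toLinearEquiv

theorem coordBasis_apply (hx : x ∈ (extChartAt (𝓡 n) p).source) (i : Fin n) :
    coordBasis p hx i = coordVec p x i := by
  simp only [coordBasis, Module.Basis.map_apply, OrthonormalBasis.coe_toBasis,
    EuclideanSpace.basisFun_apply]
  exact continuousLinearEquivAt_symm_apply hx _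

theorem coordBasis_eq (hx : x ∈ (extChartAt (𝓡 n) p).source) :
    (coordBasis p hx : Fin n → TangentSpace (𝓡 n) x) = coordVec p x :=
  funext (coordBasis_apply hx)

variable [RiemannianBundle (fun x : M => TangentSpace (𝓡 n) x)]

theorem metricMatrix_isSymm (p : M) (z : Euc n) : (metricMatrix p z).IsSymm := by
  ext i j
  simp only [metricMatrix, Matrix.transpose_apply, Matrix.of_apply]
  rw [real_inner_comm]

theorem metricMatrix_eq {z : Euc n} (hz : z ∈ (extChartAt (𝓡 n) p).target) :
    metricMatrix p z = Matrix.of fun i j =>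
      ⟪coordBasis p ((extChartAt (𝓡 n) p).map_target hz) i,
        coordBasis p ((extChartAt (𝓡 n) p).map_target hz) j⟫ := by
  ext i j
  simp only [coordBasis_apply]
  rfl

theorem inner_frame_frame (p : M) (y v w : Euc n) :
    ⟪frame p ((extChartAt (𝓡 n) p).symm y) v, frame p ((extChartAt (𝓡 n) p).symm y) w⟫ =
      ∑ b, ∑ c, metricMatrix p y b c * v b * w c := by
  rw [real_inner_comm]
  simp only [frame_apply, sum_inner, inner_sum, real_inner_smul_left, real_inner_smul_right]
  exact Finset.sum_congr rfl fun b _ => Finset.sum_congr rfl fun c _ => by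
    simp only [metricMatrix, Matrix.of_apply]
    rw [real_inner_comm]
    ring

theorem metricMatrix_det_ne_zero {z : Euc n} (hz : z ∈ (extChartAt (𝓡 n) p).target) :
    (metricMatrix p z).det ≠ 0 := by
  intro h
  obtain ⟨v, hv0, hv⟩ := Matrix.exists_mulVec_eq_zero_iff.2 h
  apply hv0
  have h1 : ⟪frame p ((extChartAt (𝓡 n) p).symm z) (WithLp.toLp 2 v),
      frame p ((extChartAt (𝓡 n) p).symm z) (WithLp.toLp 2 v)⟫ = 0 := by
    rw [inner_frame_frame]
    refine Finset.sum_eq_zero fun b _ => ?_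
    have h2 := congrFun hv b
    simp only [Matrix.mulVec, dotProduct, Pi.zero_apply] at h2
    have h3 : ∑ c, metricMatrix p z b c * v b * v c = v b * ∑ c, metricMatrix p z b c * v c := by
      rw [Finset.mul_sum]
      exact Finset.sum_congr rfl fun c _ => by ring
    simp only [h3, h2, mul_zero]
  rw [inner_self_eq_zero] at h1
  have h4 := coframe_frame ((extChartAt (𝓡 n) p).map_target hz) (WithLp.toLp 2 v)
  rw [h1, map_zero] at h4
  exact congrArg WithLp.ofLp h4.symm

theorem contDiffAt_metricMatrix
    [IsContMDiffRiemannianBundle (𝓡 n) ∞ (Euc n) (fun x : M => TangentSpace (𝓡 n) x)]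
    {z : Euc n} (hz : z ∈ (extChartAt (𝓡 n) p).target) (i j : Fin n) :
    ContDiffAt ℝ ∞ (fun z => metricMatrix p z i j) z := by
  let t := trivializationAt (Euc n) (fun y : M => TangentSpace (𝓡 n) y) p
  let b := (EuclideanSpace.basisFun (Fin n) ℝ).toBasis
  have hsymm := (contMDiffOn_extChartAt_symm (n := ∞) (I := 𝓡 n) p)
  have hF : ∀ i, ContMDiffOn 𝓘(ℝ, Euc n) ((𝓡 n).prod 𝓘(ℝ, Euc n)) ∞
      (fun z => (⟨(extChartAt (𝓡 n) p).symm z, t.localFrame b i ((extChartAt (𝓡 n) p).symm z)⟩ :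
        TotalSpace (Euc n) (fun y : M => TangentSpace (𝓡 n) y)))
      (extChartAt (𝓡 n) p).target := fun i =>
    (t.contMDiffOn_localFrame_baseSet (I := 𝓡 n) ∞ b i).comp hsymm fun z hz => by
      have := (extChartAt (𝓡 n) p).map_target hz
      simpa [t] using this
  have h := ((hF i).inner_bundle (hF j)).contMDiffAt
    ((isOpen_extChartAt_target (I := 𝓡 n) p).mem_nhds hz)
  rw [contMDiffAt_iff_contDiffAt] at h
  refine h.congr_of_eventuallyEq ?_
  filter_upwards [(isOpen_extChartAt_target (I := 𝓡 n) p).mem_nhds hz] with z' hz'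
  have hs := (extChartAt (𝓡 n) p).map_target hz'
  have hF' : ∀ i, coordVec p ((extChartAt (𝓡 n) p).symm z') i =
      t.localFrame b i ((extChartAt (𝓡 n) p).symm z') := fun i => by
    rw [t.localFrame_apply_of_mem_baseSet b (by simpa [t] using hs)]
    simp only [Trivialization.basisAt, Module.Basis.map_apply, b, OrthonormalBasis.coe_toBasis,
      EuclideanSpace.basisFun_apply]
    exact (continuousLinearEquivAt_symm_apply hs _).symm
  simp only [metricMatrix, Matrix.of_apply, hF']

end Frame

/-! ### The volume density in a chart -/

section VolumeDensity

variable {k : ℕ} {S : Type*} [TopologicalSpace S] [ChartedSpace (Euc (k + 1)) S]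
  [IsManifold (𝓡 (k + 1)) ∞ S] [RiemannianBundle (fun x : S => TangentSpace (𝓡 (k + 1)) x)]

/-- The volume form on the coordinate frame of the chart around `p`, at the point with coordinates
`z`. -/
noncomputable def volumeDensity
    (o : ∀ x : S, Orientation ℝ (TangentSpace (𝓡 (k + 1)) x) (Fin (k + 1)))
    (p : S) (z : Euc (k + 1)) : ℝ :=
  (o ((extChartAt (𝓡 (k + 1)) p).symm z)).volumeForm
    (coordVec p ((extChartAt (𝓡 (k + 1)) p).symm z))

variable {o : ∀ x : S, Orientation ℝ (TangentSpace (𝓡 (k + 1)) x) (Fin (k + 1))} {p : S}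

theorem volumeDensity_mul_self (z : Euc (k + 1)) :
    volumeDensity o p z * volumeDensity o p z = (metricMatrix p z).det :=
  volumeForm_mul_self _ _

theorem volumeDensity_ne_zero {z : Euc (k + 1)} (hz : z ∈ (extChartAt (𝓡 (k + 1)) p).target) :
    volumeDensity o p z ≠ 0 := by
  intro h
  apply metricMatrix_det_ne_zero hz
  rw [← volumeDensity_mul_self (o := o), h, zero_mul]

/-- The relation `D² = det g` leaves a sign open. Local constancy of the orientation fixes it near
`p`, so that `D` is one of `±√(det g)` there and hence smooth. -/
theorem volumeDensity_pos_iff (ho : IsManifoldOrientation o) :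
    ∀ᶠ z in 𝓝 (extChartAt (𝓡 (k + 1)) p p),
      (0 < volumeDensity o p z ↔ 0 < volumeDensity o p (extChartAt (𝓡 (k + 1)) p p)) := by
  have hcont := continuousAt_extChartAt_symm (I := 𝓡 (k + 1)) p
  have hp : (extChartAt (𝓡 (k + 1)) p).symm (extChartAt (𝓡 (k + 1)) p p) = p :=
    extChartAt_to_inv p
  have h2 := hcont.eventually (by simpa [hp] using ho p)
  filter_upwards [h2, extChartAt_target_mem_nhds (I := 𝓡 (k + 1)) p] with z hz hzt
  have hpos : ∀ (x : S) (hx : x ∈ (extChartAt (𝓡 (k + 1)) p).source),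
      0 < (o x).volumeForm (coordVec p x) ↔
      (EuclideanSpace.basisFun (Fin (k + 1)) ℝ).toBasis.orientation =
      Orientation.map (Fin (k + 1)) ((trivializationAt (Euc (k + 1))
          (fun y : S => TangentSpace (𝓡 (k + 1)) y) p).continuousLinearEquivAt ℝ x
          (by simpa using hx)).toLinearEquiv (o x) := by
    intro x hx
    rw [← coordBasis_eq hx, volumeForm_basis_pos_iff]
    have h := Orientation.map_symm (Fin (k + 1)) ((trivializationAt (Euc (k + 1))
      (fun y : S => TangentSpace (𝓡 (k + 1)) y) p).continuousLinearEquivAt ℝ x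
      (by simpa using hx)).toLinearEquiv
    rw [coordBasis, Module.Basis.orientation_map, ContinuousLinearEquiv.toLinearEquiv_symm, ← h,
      Equiv.symm_apply_eq]
  have hps : p ∈ (extChartAt (𝓡 (k + 1)) p).source := mem_extChartAt_source p
  have hzs := (extChartAt (𝓡 (k + 1)) p).map_target hzt
  have h3 := (hpos _ hzs).trans ((hz (by simpa using hzs)) ▸ (hpos p hps).symm)
  simp only [volumeDensity]
  rw [h3, hp]

theorem contDiffAt_volumeDensity (ho : IsManifoldOrientation o)
    [IsContMDiffRiemannianBundle (𝓡 (k + 1)) ∞ (Euc (k + 1))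
      (fun x : S => TangentSpace (𝓡 (k + 1)) x)] :
    ContDiffAt ℝ ∞ (volumeDensity o p) (extChartAt (𝓡 (k + 1)) p p) := by
  have ht := mem_extChartAt_target (I := 𝓡 (k + 1)) p
  have hdet : ContDiffAt ℝ ∞ (fun z => (metricMatrix p z).det) (extChartAt (𝓡 (k + 1)) p p) := by
    simp only [Matrix.det_apply]
    exact ContDiffAt.sum fun σ _ => (contDiffAt_prod fun i _ =>
      contDiffAt_metricMatrix ht _ _).const_smul _
  have hsqrt := hdet.sqrt (metricMatrix_det_ne_zero ht)
  by_cases h : 0 < volumeDensity o p (extChartAt (𝓡 (k + 1)) p p)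
  · refine hsqrt.congr_of_eventuallyEq ?_
    filter_upwards [volumeDensity_pos_iff ho] with z hz
    rw [← volumeDensity_mul_self (o := o), Real.sqrt_mul_self (hz.2 h).le]
  · refine hsqrt.neg.congr_of_eventuallyEq ?_
    filter_upwards [volumeDensity_pos_iff ho] with z hz
    rw [← volumeDensity_mul_self (o := o), Real.sqrt_mul_self_eq_abs,
      abs_of_nonpos (not_lt.1 fun h' => h (hz.1 h')), neg_neg]

end VolumeDensity

/-! ### Smooth families of alternating maps -/

section AlternatingFamilies

variable {r m : ℕ} {E F : Type*} [NormedAddCommGroup E] [NormedSpace ℝ E]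
  [NormedAddCommGroup F] [NormedSpace ℝ F] [FiniteDimensional ℝ F] {N : ℕ∞ω}

/-- Evaluation on tuples of basis vectors is an injective linear map into a finite-dimensional
space. A linear left inverse recovers the family from its values. -/
theorem contDiffAt_continuousAlternatingMap {f : E → Euc m [⋀^Fin r]→L[ℝ] F} {z : E}
    (hf : ∀ v : Fin r → Euc m, ContDiffAt ℝ N (fun z => f z v) z) : ContDiffAt ℝ N f z := by
  let b := EuclideanSpace.basisFun (Fin m) ℝ
  let T : (Euc m [⋀^Fin r]→L[ℝ] F) →ₗ[ℝ] ((Fin r → Fin m) → F) :=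
    { toFun := fun g I => g fun s => b (I s)
      map_add' := fun _ _ => rfl
      map_smul' := fun _ _ => rfl }
  have hT : LinearMap.ker T = ⊥ := by
    rw [LinearMap.ker_eq_bot]
    intro g g' h
    apply ContinuousAlternatingMap.toAlternatingMap_injective
    refine b.toBasis.ext_alternating fun I _ => ?_
    have := congrFun h I
    simp only [b.coe_toBasis]
    exact this
  obtain ⟨L, hL⟩ := T.exists_leftInverse_of_injective hT
  have h1 : f = fun z => L.toContinuousLinearMap (T (f z)) := by
    funext z
    exact (congrFun (congrArg DFunLike.coe hL) (f z)).symm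
  rw [h1]
  exact L.toContinuousLinearMap.contDiff.contDiffAt.comp z (contDiffAt_pi.2 fun I => hf _)

omit [FiniteDimensional ℝ F] in
theorem ContDiffAt.continuousAlternatingMap_apply {f : E → Euc m [⋀^Fin r]→L[ℝ] F}
    {v : Fin r → E → Euc m} {z : E} (hf : ContDiffAt ℝ N f z)
    (hv : ∀ s, ContDiffAt ℝ N (v s) z) : ContDiffAt ℝ N (fun z => f z fun s => v s z) z := by
  have h1 : (fun z => f z fun s => v s z) = fun z => ∑ I : Fin r → Fin m,
      (∏ s, v s z (I s)) • f z fun s => EuclideanSpace.basisFun (Fin m) ℝ (I s) := by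
    funext z
    have h2 := (f z).toMultilinearMap.map_sum
      (fun s (i : Fin m) => v s z i • EuclideanSpace.basisFun (Fin m) ℝ i)
    have h3 : ∀ s, ∑ i, v s z i • EuclideanSpace.basisFun (Fin m) ℝ i = v s z := fun s =>
      (EuclideanSpace.basisFun (Fin m) ℝ).sum_repr (v s z)
    simp only [h3] at h2
    refine h2.trans (Finset.sum_congr rfl fun I _ => ?_)
    exact (f z).toMultilinearMap.map_smul_univ _ _
  rw [h1]
  refine ContDiffAt.sum fun I _ => (contDiffAt_prod fun s _ =>
    contDiffAt_euclidean.1 (hv s) (I s)).smul ?_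
  exact (ContinuousAlternatingMap.apply ℝ (Euc m) F _).contDiff.contDiffAt.comp z hf

end AlternatingFamilies

/-! ### Coordinate expressions of `u`, `Q` and `α` -/

section CoordinateExpressions

variable {n m : ℕ}
  {S : Type*} [TopologicalSpace S] [ChartedSpace (Euc n) S]
  {M : Type*} [TopologicalSpace M] [ChartedSpace (Euc m) M]

/-- The coordinate expression of `u` in the charts around `p` and `u p`. -/
noncomputable def chartMap (u : S → M) (p : S) (z : Euc n) : Euc m :=
  extChartAt (𝓡 m) (u p) (u ((extChartAt (𝓡 n) p).symm z))

variable {u : S → M} {p : S}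

theorem chartMap_apply_self :
    chartMap u p (extChartAt (𝓡 n) p p) = extChartAt (𝓡 m) (u p) (u p) := by
  rw [chartMap, extChartAt_to_inv]

theorem eventually_mem_charts (hu : Continuous u) :
    ∀ᶠ z in 𝓝 (extChartAt (𝓡 n) p p), z ∈ (extChartAt (𝓡 n) p).target ∧
      u ((extChartAt (𝓡 n) p).symm z) ∈ (extChartAt (𝓡 m) (u p)).source := by
  have h1 := (hu.continuousAt.comp (continuousAt_extChartAt_symm (I := 𝓡 n) p)).eventually
    (by
      rw [Function.comp_apply, extChartAt_to_inv]
      exact extChartAt_source_mem_nhds (I := 𝓡 m) (u p))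
  exact Filter.Eventually.and (extChartAt_target_mem_nhds (I := 𝓡 n) p) h1

theorem symm_chartMap {z : Euc n}
    (hz : u ((extChartAt (𝓡 n) p).symm z) ∈ (extChartAt (𝓡 m) (u p)).source) :
    (extChartAt (𝓡 m) (u p)).symm (chartMap u p z) = u ((extChartAt (𝓡 n) p).symm z) :=
  (extChartAt (𝓡 m) (u p)).left_inv hz

variable [IsManifold (𝓡 n) ∞ S] [IsManifold (𝓡 m) ∞ M]

omit [IsManifold (𝓡 m) ∞ M] in
theorem contDiffAt_chartMap (hu : ContMDiff (𝓡 n) (𝓡 m) ∞ u) :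
    ContDiffAt ℝ ∞ (chartMap (n := n) (m := m) u p) (extChartAt (𝓡 n) p p) := by
  rw [← contMDiffAt_iff_contDiffAt]
  have h1 : ContMDiffAt 𝓘(ℝ, Euc n) (𝓡 n) ∞ (extChartAt (𝓡 n) p).symm (extChartAt (𝓡 n) p p) :=
    (contMDiffOn_extChartAt_symm p).contMDiffAt (extChartAt_target_mem_nhds (I := 𝓡 n) p)
  have h2 := hu.contMDiffAt (x := (extChartAt (𝓡 n) p).symm (extChartAt (𝓡 n) p p))
  have h3 : ContMDiffAt (𝓡 m) 𝓘(ℝ, Euc m) ∞ (extChartAt (𝓡 m) (u p))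
      (u ((extChartAt (𝓡 n) p).symm (extChartAt (𝓡 n) p p))) := by
    rw [extChartAt_to_inv]
    exact contMDiffAt_extChartAt
  exact ContMDiffAt.comp (f := u ∘ (extChartAt (𝓡 n) p).symm) (extChartAt (𝓡 n) p p) h3
    (h2.comp _ h1)

/-- The frame is the derivative of the inverse chart and the coframe is the derivative of the chart,
so this is the chain rule. -/
theorem frame_fderiv_chartMap (hu : ContMDiff (𝓡 n) (𝓡 m) ∞ u) {z : Euc n}
    (hz : z ∈ (extChartAt (𝓡 n) p).target)
    (hz' : u ((extChartAt (𝓡 n) p).symm z) ∈ (extChartAt (𝓡 m) (u p)).source) (v : Euc n) :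
    frame (u p) (u ((extChartAt (𝓡 n) p).symm z)) (fderiv ℝ (chartMap (n := n) (m := m) u p) z v) =
      differential u ((extChartAt (𝓡 n) p).symm z) (frame p ((extChartAt (𝓡 n) p).symm z) v) := by
  have hx := (extChartAt (𝓡 n) p).map_target hz
  have h1 : MDifferentiableAt 𝓘(ℝ, Euc n) (𝓡 n) (extChartAt (𝓡 n) p).symm z := by
    have := mdifferentiableWithinAt_extChartAt_symm (I := 𝓡 n) (x := p) hz
    rwa [ModelWithCorners.range_eq_univ, mdifferentiableWithinAt_univ] at this
  have hf : frame p ((extChartAt (𝓡 n) p).symm z) =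
      mfderiv 𝓘(ℝ, Euc n) (𝓡 n) (extChartAt (𝓡 n) p).symm z := by
    have := TangentBundle.symmL_trivializationAt (I := 𝓡 n) (x₀ := p)
      (x := (extChartAt (𝓡 n) p).symm z) (by simpa using hx)
    rw [ModelWithCorners.range_eq_univ, mfderivWithin_univ] at this
    rw [frame]
    refine this.trans ?_
    rw [(extChartAt (𝓡 n) p).right_inv hz]
  have h2 : MDifferentiableAt (𝓡 n) (𝓡 m) u ((extChartAt (𝓡 n) p).symm z) :=
    hu.mdifferentiable (by simp) _
  have h3 : MDifferentiableAt (𝓡 m) 𝓘(ℝ, Euc m) (extChartAt (𝓡 m) (u p))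
      (u ((extChartAt (𝓡 n) p).symm z)) :=
    mdifferentiableAt_extChartAt (by simpa using hz')
  have hc : coframe (u p) (u ((extChartAt (𝓡 n) p).symm z)) =
      mfderiv (𝓡 m) 𝓘(ℝ, Euc m) (extChartAt (𝓡 m) (u p)) (u ((extChartAt (𝓡 n) p).symm z)) :=
    TangentBundle.continuousLinearMapAt_trivializationAt (by simpa using hz')
  have h4 : HasMFDerivAt 𝓘(ℝ, Euc n) 𝓘(ℝ, Euc m) (chartMap (n := n) (m := m) u p) z _ :=
    h3.hasMFDerivAt.comp z (h2.hasMFDerivAt.comp z h1.hasMFDerivAt)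
  rw [← hc, ← hf] at h4
  have h5 := h4.mfderiv
  rw [mfderiv_eq_fderiv] at h5
  have h6 : fderiv ℝ (chartMap (n := n) (m := m) u p) z v = coframe (u p) (u ((extChartAt (𝓡 n) p).symm z))
      (differential u ((extChartAt (𝓡 n) p).symm z)
        (frame p ((extChartAt (𝓡 n) p).symm z) v)) :=
    DFunLike.congr_fun h5 v
  rw [h6, frame_coframe hz']

variable [RiemannianBundle (fun y : M => TangentSpace (𝓡 m) y)] {k : ℕ}

/-- The coordinate expression of a family of vector cross products in the chart around `q`. -/
noncomputable def crossCoord (Q : ∀ y : M, VectorCrossProduct k (TangentSpace (𝓡 m) y)) (q : M)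
    (y : Euc m) : Euc m [⋀^Fin k]→L[ℝ] Euc m :=
  (coframe q ((extChartAt (𝓡 m) q).symm y)).compContinuousAlternatingMap
    ((Q ((extChartAt (𝓡 m) q).symm y)).toAlt.compContinuousLinearMap
      (frame q ((extChartAt (𝓡 m) q).symm y)))

/-- The coordinate expression of the calibration form in the chart around `q`. -/
noncomputable def calibrationCoord (Q : ∀ y : M, VectorCrossProduct k (TangentSpace (𝓡 m) y))
    (q : M) (y : Euc m) : Euc m [⋀^Fin (k + 1)]→L[ℝ] ℝ :=
  ((Q ((extChartAt (𝓡 m) q).symm y)).calibrationForm).compContinuousLinearMap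
    (frame q ((extChartAt (𝓡 m) q).symm y))

variable {Q : ∀ y : M, VectorCrossProduct k (TangentSpace (𝓡 m) y)} {q : M} {y : Euc m}

theorem contDiffAt_crossCoord (hQ : IsSmoothVCP Q) (hy : y ∈ (extChartAt (𝓡 m) q).target) :
    ContDiffAt ℝ ∞ (crossCoord Q q) y :=
  contDiffAt_continuousAlternatingMap fun v =>
    (hQ q v).contDiffAt ((isOpen_extChartAt_target (I := 𝓡 m) q).mem_nhds hy)

theorem frame_crossCoord (hy : y ∈ (extChartAt (𝓡 m) q).target) (v : Fin k → Euc m) :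
    frame q ((extChartAt (𝓡 m) q).symm y) (crossCoord Q q y v) =
      (Q ((extChartAt (𝓡 m) q).symm y)).toAlt
        fun r => frame q ((extChartAt (𝓡 m) q).symm y) (v r) :=
  frame_coframe ((extChartAt (𝓡 m) q).map_target hy) _

theorem calibrationCoord_apply (hy : y ∈ (extChartAt (𝓡 m) q).target)
    (v : Fin (k + 1) → Euc m) : calibrationCoord Q q y v =
      ∑ b, ∑ c, metricMatrix q y b c * crossCoord Q q y (Fin.init v) b * v (Fin.last k) c := by
  rw [← inner_frame_frame, frame_crossCoord hy]
  rfl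

theorem contDiffAt_calibrationCoord
    [IsContMDiffRiemannianBundle (𝓡 m) ∞ (Euc m) (fun y : M => TangentSpace (𝓡 m) y)]
    (hQ : IsSmoothVCP Q) (hy : y ∈ (extChartAt (𝓡 m) q).target) :
    ContDiffAt ℝ ∞ (calibrationCoord Q q) y := by
  refine contDiffAt_continuousAlternatingMap fun v => ?_
  have h1 : ContDiffAt ℝ ∞ (fun y => ∑ b, ∑ c, metricMatrix q y b c *
      crossCoord Q q y (Fin.init v) b * v (Fin.last k) c) y :=
    ContDiffAt.sum fun b _ => ContDiffAt.sum fun c _ =>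
      ((contDiffAt_metricMatrix hy b c).mul (contDiffAt_euclidean.1
        ((contDiffAt_crossCoord hQ hy).continuousAlternatingMap_apply
          fun s => contDiffAt_const) b)).mul contDiffAt_const
  refine h1.congr_of_eventuallyEq ?_
  filter_upwards [(isOpen_extChartAt_target (I := 𝓡 m) q).mem_nhds hy] with y' hy'
  exact calibrationCoord_apply hy' v

end CoordinateExpressions

/-! ### The section `Q(Λᵏ du)∗` in an arbitrary frame -/

section CrossStar

variable {V : Type*} [NormedAddCommGroup V] [InnerProductSpace ℝ V] [FiniteDimensional ℝ V]
  {W : Type*} [NormedAddCommGroup W] [InnerProductSpace ℝ W]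
  {k : ℕ} [Fact (Module.finrank ℝ V = k + 1)] (o : Orientation ℝ V (Fin (k + 1)))

/-- This is `w♭ ∧ η = η(∗w) vol` for the pullback `η` of `P` by `A`. With `v` a coordinate frame, it
gives a manifestly smooth formula in which no orthonormal frame occurs. -/
theorem volumeForm_smul_crossStar (P : W [⋀^Fin k]→ₗ[ℝ] W) (A : V →ₗ[ℝ] W) (w : V)
    (v : Fin (k + 1) → V) : o.volumeForm v • crossStar o P A w =
      ∑ i : Fin (k + 1), ((-1 : ℝ) ^ (i : ℕ) * ⟪w, v i⟫) • P fun r => A (v (i.succAbove r)) := by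
  have h1 : exteriorPower.alternatingMapLinearEquiv P ∘ₗ exteriorPower.map k A =
      exteriorPower.alternatingMapLinearEquiv (P.compLinearMap A) := by
    apply exteriorPower.linearMap_ext
    ext v
    simp [exteriorPower.map_apply_ιMulti, exteriorPower.alternatingMapLinearEquiv_apply_ιMulti]
    rfl
  have h2 : crossStar o P A w =
      exteriorPower.alternatingMapLinearEquiv (P.compLinearMap A) (hodgeStarVec o w) := by
    rw [← h1]
    rfl
  rw [h2, volumeForm_smul_alternatingMap_hodgeStarVec]
  refine Finset.sum_congr rfl fun i _ => ?_
  rw [← Int.cast_smul_eq_zsmul ℝ, smul_smul]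
  push_cast
  rfl

end CrossStar

/-! ### First variation at equality in the bound -/

section FirstVariation

theorem partialDeriv_apply {n m : ℕ} {U : Euc n → Euc m} {z : Euc n}
    (hU : DifferentiableAt ℝ U z) (i : Fin n) (b : Fin m) :
    partialDeriv i (fun z => U z b) z = fderiv ℝ U z (EuclideanSpace.single i 1) b := by
  have : HasFDerivAt (fun z => U z b) ((EuclideanSpace.proj b).comp (fderiv ℝ U z)) z :=
    (EuclideanSpace.proj b : Euc m →L[ℝ] ℝ).hasFDerivAt.comp z hU.hasFDerivAt
  rw [partialDeriv, this.fderiv]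
  rfl

/-- The derivative at a point of equality in `(k + 1) ^ (k + 1) f² ≤ E ^ (k + 1)`. -/
theorem partialDeriv_eq_of_sq_le {k m : ℕ} (hk : 1 ≤ k) {f E : Euc m → ℝ} {y : Euc m}
    (hf : DifferentiableAt ℝ f y) (hE : DifferentiableAt ℝ E y)
    (hle : ∀ y, ((k + 1 : ℕ) : ℝ) ^ (k + 1) * f y ^ 2 ≤ E y ^ (k + 1)) {ε s μ : ℝ}
    (hε : ε * ε = 1) (hμ : μ ≠ 0) (hs : μ ^ (k - 1) = s) (hfy : f y = ε * s * μ ^ 2)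
    (hEy : E y = ((k + 1 : ℕ) : ℝ) * μ ^ 2) (t : Fin m) :
    partialDeriv t f y = (1 / 2) * (ε * s) * partialDeriv t E y := by
  have hs0 : s ≠ 0 := hs ▸ pow_ne_zero _ hμ
  have hn0 : ((k + 1 : ℕ) : ℝ) ≠ 0 := by positivity
  have hpow : (μ ^ 2) ^ k = s ^ 2 * μ ^ 2 := by
    rw [← hs, ← pow_mul, ← pow_mul, ← pow_add]
    congr 1
    omega
  -- The difference of the two sides is nonnegative and vanishes at `y`, so its derivative is zero
  -- there.
  have hmin : IsLocalMin (fun y => E y ^ (k + 1) - ((k + 1 : ℕ) : ℝ) ^ (k + 1) * f y ^ 2) y := by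
    refine Filter.Eventually.of_forall fun y' => ?_
    have h0 : E y ^ (k + 1) - ((k + 1 : ℕ) : ℝ) ^ (k + 1) * f y ^ 2 = 0 := by
      rw [hfy, hEy, mul_pow, pow_succ (μ ^ 2), hpow]
      linear_combination (-((k + 1 : ℕ) : ℝ) ^ (k + 1) * s ^ 2 * μ ^ 4) * hε
    beta_reduce
    rw [h0]
    exact sub_nonneg.2 (hle y')
  have hd := hmin.fderiv_eq_zero
  have h1 : HasFDerivAt (fun y => E y ^ (k + 1) - ((k + 1 : ℕ) : ℝ) ^ (k + 1) * f y ^ 2) _ y :=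
    (hE.hasFDerivAt.pow (k + 1)).sub ((hf.hasFDerivAt.pow 2).const_mul _)
  rw [h1.fderiv] at hd
  have h2 := DFunLike.congr_fun hd (EuclideanSpace.single t 1)
  simp only [sub_apply, smul_apply, zero_apply, smul_eq_mul, nsmul_eq_mul] at h2
  change _ * partialDeriv t E y - _ * (_ * partialDeriv t f y) = 0 at h2
  rw [hfy, hEy, show k + 1 - 1 = k by omega, mul_pow, hpow] at h2
  -- This common factor is what `μ ≠ 0` allows to be cancelled; at `μ = 0` the derivative of the
  -- inequality carries no information.
  have hc : ((k + 1 : ℕ) : ℝ) ^ (k + 1) * s * μ ^ 2 ≠ 0 :=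
    mul_ne_zero (mul_ne_zero (pow_ne_zero _ hn0) hs0) (pow_ne_zero _ hμ)
  have h3 : ε * partialDeriv t f y = (1 / 2) * s * partialDeriv t E y := by
    refine mul_left_cancel₀ hc ?_
    push_cast at h2 ⊢
    linear_combination (-1 / 2) * h2
  linear_combination ε * h3 - partialDeriv t f y * hε

end FirstVariation

/-! ### The dual density and closedness of `α` -/

section Coordinates

variable {k m : ℕ}
  {S : Type*} [TopologicalSpace S] [ChartedSpace (Euc (k + 1)) S] [IsManifold (𝓡 (k + 1)) ∞ S]
  {M : Type*} [TopologicalSpace M] [ChartedSpace (Euc m) M] [IsManifold (𝓡 m) ∞ M]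

/-- The partial derivative `∂ᵢ u` of the coordinate expression of `u`. -/
noncomputable def chartMapDeriv (u : S → M) (p : S) (i : Fin (k + 1)) (z : Euc (k + 1)) : Euc m :=
  fderiv ℝ (chartMap (n := k + 1) (m := m) u p) z (EuclideanSpace.single i 1)

variable {u : S → M} {p : S}

omit [IsManifold (𝓡 (k + 1)) ∞ S] [IsManifold (𝓡 m) ∞ M] in
theorem chartMap_self_mem_target :
    chartMap u p (extChartAt (𝓡 (k + 1)) p p) ∈ (extChartAt (𝓡 m) (u p)).target := by
  rw [chartMap_apply_self]
  exact mem_extChartAt_target (I := 𝓡 m) (u p)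

omit [IsManifold (𝓡 m) ∞ M] in
theorem contDiffAt_chartMapDeriv (hu : ContMDiff (𝓡 (k + 1)) (𝓡 m) ∞ u) (i : Fin (k + 1)) :
    ContDiffAt ℝ ∞ (chartMapDeriv (m := m) u p i) (extChartAt (𝓡 (k + 1)) p p) :=
  ((contDiffAt_chartMap hu).fderiv_right (m := ∞) (by simp)).clm_apply contDiffAt_const

variable [RiemannianBundle (fun y : M => TangentSpace (𝓡 m) y)]
  {Q : ∀ y : M, VectorCrossProduct k (TangentSpace (𝓡 m) y)}

omit [IsManifold (𝓡 (k + 1)) ∞ S] in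
theorem crossCoord_chartMap {z : Euc (k + 1)}
    (hz : u ((extChartAt (𝓡 (k + 1)) p).symm z) ∈ (extChartAt (𝓡 m) (u p)).source)
    (v : Fin k → Euc m) : crossCoord Q (u p) (chartMap u p z) v =
      coframe (u p) (u ((extChartAt (𝓡 (k + 1)) p).symm z))
        ((Q (u ((extChartAt (𝓡 (k + 1)) p).symm z))).toAlt
          fun r => frame (u p) (u ((extChartAt (𝓡 (k + 1)) p).symm z)) (v r)) := by
  rw [← symm_chartMap hz]
  rfl

variable [RiemannianBundle (fun x : S => TangentSpace (𝓡 (k + 1)) x)]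
  {o : ∀ x : S, Orientation ℝ (TangentSpace (𝓡 (k + 1)) x) (Fin (k + 1))}

/-- The coordinate expression of `Q (Λᵏ du) ∗` applied to a coordinate vector. -/
noncomputable def crossStarCoord
    (o : ∀ x : S, Orientation ℝ (TangentSpace (𝓡 (k + 1)) x) (Fin (k + 1)))
    (Q : ∀ y : M, VectorCrossProduct k (TangentSpace (𝓡 m) y)) (u : S → M) (p : S)
    (j : Fin (k + 1)) (z : Euc (k + 1)) : Euc m :=
  (volumeDensity o p z)⁻¹ • ∑ i : Fin (k + 1), ((-1 : ℝ) ^ (i : ℕ) * metricMatrix p z j i) •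
    crossCoord Q (u p) (chartMap u p z) fun r => chartMapDeriv u p (i.succAbove r) z

/-- The components of the vector density dual to `Q (Λᵏ du) ∗` paired with a coordinate vector. -/
noncomputable def crossStarDensity (Q : ∀ y : M, VectorCrossProduct k (TangentSpace (𝓡 m) y))
    (u : S → M) (p : S) (a : Fin m) (i : Fin (k + 1)) (z : Euc (k + 1)) : ℝ :=
  (-1) ^ (i : ℕ) * ((-1) ^ k * calibrationCoord Q (u p) (chartMap u p z)
    (Matrix.vecCons (EuclideanSpace.single a 1) fun r => chartMapDeriv u p (i.succAbove r) z))

theorem sectionCoord_crossStarSection (hu : ContMDiff (𝓡 (k + 1)) (𝓡 m) ∞ u) {z : Euc (k + 1)}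
    (hz : z ∈ (extChartAt (𝓡 (k + 1)) p).target)
    (hz' : u ((extChartAt (𝓡 (k + 1)) p).symm z) ∈ (extChartAt (𝓡 m) (u p)).source)
    (a : Fin m) (j : Fin (k + 1)) :
    sectionCoord u (crossStarSection o Q u) p a j z = crossStarCoord o Q u p j z a := by
  have h := volumeForm_smul_crossStar (o ((extChartAt (𝓡 (k + 1)) p).symm z))
    (Q (u ((extChartAt (𝓡 (k + 1)) p).symm z))).toAlt.toAlternatingMap
    (differential u ((extChartAt (𝓡 (k + 1)) p).symm z))
    (coordVec p ((extChartAt (𝓡 (k + 1)) p).symm z) j)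
    (coordVec p ((extChartAt (𝓡 (k + 1)) p).symm z))
  have h1 : ∀ i, differential u ((extChartAt (𝓡 (k + 1)) p).symm z)
      (coordVec p ((extChartAt (𝓡 (k + 1)) p).symm z) i) =
      frame (u p) (u ((extChartAt (𝓡 (k + 1)) p).symm z)) (chartMapDeriv u p i z) := fun i =>
    (frame_fderiv_chartMap hu hz hz' _).symm
  simp only [h1] at h
  have h2 := congrArg (coframe (u p) (u ((extChartAt (𝓡 (k + 1)) p).symm z))) h
  rw [map_smul, map_sum] at h2
  simp only [map_smul] at h2
  have h3 : coframe (u p) (u ((extChartAt (𝓡 (k + 1)) p).symm z))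
      (crossStarSection o Q u ((extChartAt (𝓡 (k + 1)) p).symm z)
        (coordVec p ((extChartAt (𝓡 (k + 1)) p).symm z) j)) = crossStarCoord o Q u p j z := by
    rw [crossStarCoord, eq_inv_smul_iff₀ (volumeDensity_ne_zero hz)]
    refine h2.trans (Finset.sum_congr rfl fun i _ => ?_)
    rw [crossCoord_chartMap hz']
    rfl
  rw [← h3]
  rfl

theorem sum_metricMatrix_mul_crossStarCoord {z : Euc (k + 1)}
    (hz : chartMap u p z ∈ (extChartAt (𝓡 m) (u p)).target) (a : Fin m) (j : Fin (k + 1)) :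
    ∑ d, metricMatrix (u p) (chartMap u p z) a d * crossStarCoord o Q u p j z d =
      (volumeDensity o p z)⁻¹ * ∑ i, metricMatrix p z j i * crossStarDensity Q u p a i z := by
  have h1 : ∀ i : Fin (k + 1), crossStarDensity Q u p a i z = (-1) ^ (i : ℕ) *
      ∑ b, metricMatrix (u p) (chartMap u p z) a b *
        crossCoord Q (u p) (chartMap u p z) (fun r => chartMapDeriv u p (i.succAbove r) z) b := by
    intro i
    -- The metric pairs the cross product with the last slot, whereas the contraction `ι_{∂ₐ}` uses
    -- the first. Moving `∂ₐ` across `k` slots is the source of `(-1)^k` in `crossStarDensity`.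
    have h2 := (calibrationCoord Q (u p) (chartMap u p z)).toAlternatingMap.map_snoc
      (fun r => chartMapDeriv u p (i.succAbove r) z) (EuclideanSpace.single a 1)
    have h3 := calibrationCoord_apply (Q := Q) hz
      (Fin.snoc (fun r => chartMapDeriv u p (i.succAbove r) z) (EuclideanSpace.single a 1))
    rw [crossStarDensity]
    congr 1
    have h4 : (-1 : ℝ) ^ k * calibrationCoord Q (u p) (chartMap u p z)
        (Matrix.vecCons (EuclideanSpace.single a 1) fun r => chartMapDeriv u p (i.succAbove r) z) =
        calibrationCoord Q (u p) (chartMap u p z)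
          (Fin.snoc (fun r => chartMapDeriv u p (i.succAbove r) z) (EuclideanSpace.single a 1)) := by
      rw [← Int.cast_smul_eq_zsmul ℝ] at h2
      push_cast at h2
      exact h2.symm
    rw [h4, h3]
    refine Finset.sum_congr rfl fun b _ => ?_
    rw [Finset.sum_eq_single a]
    · simp only [Fin.init_snoc, Fin.snoc_last, PiLp.single_apply, if_true, mul_one]
      rw [(metricMatrix_isSymm (u p) (chartMap u p z)).apply a b]
    · intro c _ hc
      simp [hc]
    · simp
  simp only [h1, crossStarCoord, PiLp.smul_apply, WithLp.ofLp_sum, Finset.sum_apply, smul_eq_mul,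
    WithLp.ofLp_smul, Pi.smul_apply]
  simp only [Finset.mul_sum]
  rw [Finset.sum_comm]
  exact Finset.sum_congr rfl fun i _ => Finset.sum_congr rfl fun d _ => by ring

variable [IsContMDiffRiemannianBundle (𝓡 (k + 1)) ∞ (Euc (k + 1))
      (fun x : S => TangentSpace (𝓡 (k + 1)) x)]
    [IsContMDiffRiemannianBundle (𝓡 m) ∞ (Euc m) (fun y : M => TangentSpace (𝓡 m) y)]

omit [IsContMDiffRiemannianBundle (𝓡 m) ∞ (Euc m) (fun y : M => TangentSpace (𝓡 m) y)] in
theorem contDiffAt_crossStarCoord (ho : IsManifoldOrientation o) (hQ : IsSmoothVCP Q)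
    (hu : ContMDiff (𝓡 (k + 1)) (𝓡 m) ∞ u) (j : Fin (k + 1)) :
    ContDiffAt ℝ ∞ (crossStarCoord o Q u p j) (extChartAt (𝓡 (k + 1)) p p) := by
  have ht := mem_extChartAt_target (I := 𝓡 (k + 1)) p
  refine ((contDiffAt_volumeDensity ho).inv (volumeDensity_ne_zero ht)).smul
    (ContDiffAt.sum fun i _ => (contDiffAt_const.mul (contDiffAt_metricMatrix ht _ _)).smul ?_)
  exact ContDiffAt.continuousAlternatingMap_apply
    ((contDiffAt_crossCoord hQ chartMap_self_mem_target).comp _ (contDiffAt_chartMap hu))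
    fun r => contDiffAt_chartMapDeriv hu _

omit [RiemannianBundle (fun x : S => TangentSpace (𝓡 (k + 1)) x)]
  [IsContMDiffRiemannianBundle (𝓡 (k + 1)) ∞ (Euc (k + 1))
    (fun x : S => TangentSpace (𝓡 (k + 1)) x)] in
theorem contDiffAt_crossStarDensity (hQ : IsSmoothVCP Q)
    (hu : ContMDiff (𝓡 (k + 1)) (𝓡 m) ∞ u) (a : Fin m) (i : Fin (k + 1)) :
    ContDiffAt ℝ ∞ (crossStarDensity Q u p a i) (extChartAt (𝓡 (k + 1)) p p) := by
  refine contDiffAt_const.mul (contDiffAt_const.mul ?_)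
  have h := ContDiffAt.continuousAlternatingMap_apply (N := ∞)
    (f := fun z => calibrationCoord Q (u p) (chartMap u p z))
    (v := Matrix.vecCons (fun _ => EuclideanSpace.single a 1)
      fun r => chartMapDeriv u p (i.succAbove r)) (z := extChartAt (𝓡 (k + 1)) p p)
    ((contDiffAt_calibrationCoord hQ chartMap_self_mem_target).comp _ (contDiffAt_chartMap hu))
    (by
      intro s
      induction s using Fin.cases with
      | zero => exact contDiffAt_const
      | succ r => exact contDiffAt_chartMapDeriv hu _)
  convert! h using 2 with z
  congr 1
  funext s
  induction s using Fin.cases with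
  | zero => rfl
  | succ r => rfl

omit [RiemannianBundle (fun x : S => TangentSpace (𝓡 (k + 1)) x)]
  [IsContMDiffRiemannianBundle (𝓡 (k + 1)) ∞ (Euc (k + 1))
    (fun x : S => TangentSpace (𝓡 (k + 1)) x)] in
/-- The divergence of the density dual to `Q (Λᵏ du) ∗`, from the closedness of the calibration
form. -/
theorem sum_partialDeriv_crossStarDensity (hQ : IsSmoothVCP Q)
    (hα : IsClosedForm fun y => (Q y).calibrationForm)
    (hu : ContMDiff (𝓡 (k + 1)) (𝓡 m) ∞ u) (a : Fin m) :
    ∑ i, partialDeriv i (crossStarDensity Q u p a i) (extChartAt (𝓡 (k + 1)) p p) =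
      (-1) ^ k * partialDeriv a (fun y => calibrationCoord Q (u p) y
        fun i => chartMapDeriv u p i (extChartAt (𝓡 (k + 1)) p p))
        (chartMap u p (extChartAt (𝓡 (k + 1)) p p)) := by
  set z₀ := extChartAt (𝓡 (k + 1)) p p with hz₀
  set U : Euc (k + 1) → Euc m := chartMap u p with hU
  set α := calibrationCoord Q (u p) with hαdef
  have hUd : ContDiffAt ℝ ∞ U z₀ := contDiffAt_chartMap hu
  have hyt : U z₀ ∈ (extChartAt (𝓡 m) (u p)).target := chartMap_self_mem_target
  have hαd : DifferentiableAt ℝ α (U z₀) :=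
    (contDiffAt_calibrationCoord hQ hyt).differentiableAt (by simp)
  let e : Fin (k + 1) → Euc (k + 1) := fun i => EuclideanSpace.single i 1
  -- Here `η = ι_{∂ₐ} α`. Up to `(-1)^k`, the divergence of the density is `d(U*η)` on the standard
  -- basis, and `d` commutes with pullback, so second derivatives of `u` drop out.
  let η : Euc m → Euc m [⋀^Fin k]→L[ℝ] ℝ := fun y => (α y).curryLeft (EuclideanSpace.single a 1)
  have hη : DifferentiableAt ℝ η (U z₀) := by
    refine (contDiffAt_continuousAlternatingMap (N := ∞) fun v => ?_).differentiableAt (by simp)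
    exact ContDiffAt.continuousAlternatingMap_apply
      (v := fun s _ => Matrix.vecCons (EuclideanSpace.single a 1) v s)
      (contDiffAt_calibrationCoord hQ hyt) fun s => contDiffAt_const
  have hpull := extDeriv_pullback hη hUd (r := ∞)
    (by rw [minSmoothness_of_isRCLikeNormedField]; exact ENat.LEInfty.out)
  have h1 := DFunLike.congr_fun hpull e
  have hpd : DifferentiableAt ℝ (fun z => (η (U z)).compContinuousLinearMap (fderiv ℝ U z)) z₀ :=
    (hη.comp z₀ (hUd.differentiableAt (by simp))).continuousAlternatingMapCompContinuousLinearMap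
      ((hUd.fderiv_right (m := ∞) (by simp)).differentiableAt (by simp))
  rw [extDeriv_apply hpd, ContinuousAlternatingMap.compContinuousLinearMap_apply,
    extDeriv_apply hη] at h1
  have h2 := hα (u p) (U z₀) hyt
  have h3 : (extDeriv α (U z₀)) (Matrix.vecCons (EuclideanSpace.single a 1)
      fun i => chartMapDeriv u p i z₀) = 0 := by
    have : extDeriv α (U z₀) = 0 := h2
    rw [this]
    rfl
  -- Cartan's formula for the constant field `∂ₐ`: in `dα(∂ₐ, ∂₀u, …, ∂ₖu) = 0` the leading term
  -- differentiates `α` along `∂ₐ`, and the others add up to `-dη(∂₀u, …, ∂ₖu)`.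
  rw [extDeriv_apply hαd, Fin.sum_univ_succ] at h3
  have h4 : ∀ i : Fin (k + 1), partialDeriv i (crossStarDensity Q u p a i) z₀ =
      (-1) ^ k * ((-1 : ℝ) ^ (i : ℕ) * (fderiv ℝ (fun z =>
        ((η (U z)).compContinuousLinearMap (fderiv ℝ U z)) (i.removeNth e)) z₀) (e i)) := by
    intro i
    have h5 : DifferentiableAt ℝ (fun z =>
        ((η (U z)).compContinuousLinearMap (fderiv ℝ U z)) (i.removeNth e)) z₀ :=
      ((ContinuousAlternatingMap.apply ℝ (Euc (k + 1)) ℝ (i.removeNth e)).differentiableAt.comp z₀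
        hpd :)
    have h6 : crossStarDensity Q u p a i = fun z => ((-1 : ℝ) ^ (i : ℕ) * (-1) ^ k) *
        ((η (U z)).compContinuousLinearMap (fderiv ℝ U z)) (i.removeNth e) := by
      funext z
      rw [mul_assoc]
      rfl
    rw [h6, partialDeriv, fderiv_const_mul h5]
    simp only [smul_apply, smul_eq_mul]
    ring
  simp only [h4, ← Finset.mul_sum]
  congr 1
  simp only [zsmul_eq_mul, Int.cast_pow, Int.cast_neg, Int.cast_one] at h1 h3
  rw [h1]
  have h7 : ∀ i : Fin (k + 1), (i.succ.removeNth (Matrix.vecCons (EuclideanSpace.single a (1 : ℝ))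
      fun i => chartMapDeriv (m := m) u p i z₀) : Fin (k + 1) → Euc m) =
      Matrix.vecCons (EuclideanSpace.single a 1) (i.removeNth fun i => chartMapDeriv u p i z₀) := by
    intro i
    funext s
    induction s using Fin.cases with
    | zero => rfl
    | succ r => simp [Fin.removeNth]
  simp only [h7, Fin.val_zero, pow_zero, one_mul, Fin.val_succ, pow_succ, mul_neg, mul_one,
    neg_mul, Finset.sum_neg_distrib] at h3
  exact (sub_eq_zero.1 (by rw [sub_eq_add_neg]; exact h3)).symm

end Coordinates

theorem sum_quadratic_form_sum {ι β κ : Type*} [Fintype ι] [Fintype β] [Fintype κ]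
    (δ : β → β → ℝ) (r : κ → ι → ℝ) (w : ι → β → ℝ) :
    ∑ l, ∑ b, ∑ c, δ b c * (∑ i, r l i * w i b) * (∑ j, r l j * w j c) =
      ∑ i, ∑ j, (∑ l, r l i * r l j) * ∑ b, ∑ c, δ b c * w i b * w j c := by
  have h1 : ∀ l, ∑ b, ∑ c, δ b c * (∑ i, r l i * w i b) * (∑ j, r l j * w j c) =
      ∑ i, ∑ j, r l i * r l j * ∑ b, ∑ c, δ b c * w i b * w j c := by
    intro l
    simp only [Finset.mul_sum, Finset.sum_mul]
    symm
    calc _ = ∑ i, ∑ b, ∑ j, ∑ c, r l i * r l j * (δ b c * w i b * w j c) :=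
          Finset.sum_congr rfl fun i _ => Finset.sum_comm
      _ = ∑ b, ∑ i, ∑ j, ∑ c, r l i * r l j * (δ b c * w i b * w j c) := Finset.sum_comm
      _ = ∑ b, ∑ i, ∑ c, ∑ j, r l i * r l j * (δ b c * w i b * w j c) :=
          Finset.sum_congr rfl fun b _ => Finset.sum_congr rfl fun i _ => Finset.sum_comm
      _ = ∑ b, ∑ c, ∑ i, ∑ j, r l i * r l j * (δ b c * w i b * w j c) :=
          Finset.sum_congr rfl fun b _ => Finset.sum_comm
      _ = ∑ b, ∑ c, ∑ j, ∑ i, r l i * r l j * (δ b c * w i b * w j c) :=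
          Finset.sum_congr rfl fun b _ => Finset.sum_congr rfl fun c _ => Finset.sum_comm
      _ = _ := Finset.sum_congr rfl fun b _ => Finset.sum_congr rfl fun c _ =>
          Finset.sum_congr rfl fun j _ => Finset.sum_congr rfl fun i _ => by ring
  simp only [h1]
  rw [Finset.sum_comm]
  refine Finset.sum_congr rfl fun i _ => ?_
  rw [Finset.sum_comm]
  exact Finset.sum_congr rfl fun j _ => (Finset.sum_mul ..).symm

/-! ### First variation of `α` along a Smith map -/

section Coordinates

variable {k m : ℕ}
  {S : Type*} [TopologicalSpace S] [ChartedSpace (Euc (k + 1)) S] [IsManifold (𝓡 (k + 1)) ∞ S]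
  [RiemannianBundle (fun x : S => TangentSpace (𝓡 (k + 1)) x)]
  {M : Type*} [TopologicalSpace M] [ChartedSpace (Euc m) M] [IsManifold (𝓡 m) ∞ M]
  [RiemannianBundle (fun y : M => TangentSpace (𝓡 m) y)]
  [IsContMDiffRiemannianBundle (𝓡 m) ∞ (Euc m) (fun y : M => TangentSpace (𝓡 m) y)]
  {Q : ∀ y : M, VectorCrossProduct k (TangentSpace (𝓡 m) y)}
  {o : ∀ x : S, Orientation ℝ (TangentSpace (𝓡 (k + 1)) x) (Fin (k + 1))}
  {u : S → M} {p : S}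

set_option maxHeartbeats 2000000 in
/-- The first variation, in the target directions, of the calibration form along a Smith map. -/
theorem partialDeriv_calibrationCoord (hQ : IsSmoothVCP Q)
    (hu : ContMDiff (𝓡 (k + 1)) (𝓡 m) ∞ u) {z : Euc (k + 1)}
    (hz : z ∈ (extChartAt (𝓡 (k + 1)) p).target)
    (hz' : u ((extChartAt (𝓡 (k + 1)) p).symm z) ∈ (extChartAt (𝓡 m) (u p)).source) {c : ℝ}
    (hc : 0 < c)
    (h : exteriorPower.alternatingMapLinearEquiv
          (Q (u ((extChartAt (𝓡 (k + 1)) p).symm z))).toAlt.toAlternatingMap ∘ₗ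
        exteriorPower.map k (differential u ((extChartAt (𝓡 (k + 1)) p).symm z)) =
      c ^ (k - 1) • (differential u ((extChartAt (𝓡 (k + 1)) p).symm z) ∘ₗ
        exteriorPower.alternatingMapLinearEquiv
          (hodgeStar (o ((extChartAt (𝓡 (k + 1)) p).symm z))))) (t : Fin m) :
    partialDeriv t (fun y => calibrationCoord Q (u p) y fun i => chartMapDeriv u p i z)
        (chartMap u p z) =
      (1 / 2) * c ^ (k - 1) * volumeDensity o p z * ∑ i, ∑ j, (metricMatrix p z)⁻¹ i j *
        ∑ b, ∑ d, partialDeriv t (fun y => metricMatrix (u p) y b d) (chartMap u p z) *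
          chartMapDeriv u p i z b * chartMapDeriv u p j z d := by
  have hx := (extChartAt (𝓡 (k + 1)) p).map_target hz
  have hsymm := symm_chartMap hz'
  have hyt : chartMap u p z ∈ (extChartAt (𝓡 m) (u p)).target :=
    (extChartAt (𝓡 m) (u p)).map_source hz'
  have hfr : ∀ i, frame (u p) (u ((extChartAt (𝓡 (k + 1)) p).symm z)) (chartMapDeriv u p i z) =
      differential u ((extChartAt (𝓡 (k + 1)) p).symm z)
        (coordVec p ((extChartAt (𝓡 (k + 1)) p).symm z) i) :=
    fun i => frame_fderiv_chartMap hu hz hz' _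
  set x := (extChartAt (𝓡 (k + 1)) p).symm z with hxdef
  have hG : (metricMatrix p z) = _ := metricMatrix_eq hz
  have hD : volumeDensity o p z = (o x).volumeForm (coordBasis p hx : Fin (k + 1) → TangentSpace (𝓡 (k + 1)) x) := by
    rw [coordBasis_eq]
    rfl
  set bs := coordBasis p hx with hbs
  set w : Fin (k + 1) → Euc m := fun i => chartMapDeriv u p i z with hw
  obtain ⟨e, -⟩ := exists_orthonormalBasis_hilbertSchmidtNorm (V := TangentSpace (𝓡 (k + 1)) x)
    (W := TangentSpace (𝓡 m) (u x)) (k := k)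
  -- `L` is `du` at `x` read in the target chart. It stays fixed while the base point `y` varies, so
  -- only the coefficients of `α` and `h` are differentiated.
  let L : TangentSpace (𝓡 (k + 1)) x →ₗ[ℝ] Euc m := bs.constr ℝ w
  have hLb : ∀ i, L (bs i) = w i := fun i => bs.constr_basis ℝ w i
  have hLA : ∀ v, frame (u p) (u x) (L v) = differential u x v := by
    intro v
    have : (frame (n := m) (u p) (u x)).toLinearMap ∘ₗ L = differential u x := bs.ext fun i => by
      rw [LinearMap.comp_apply, hLb, hbs, coordBasis_apply hx]
      exact hfr i
    exact LinearMap.congr_fun this v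
  have hLe : ∀ l b, L (e l) b = ∑ i, bs.repr (e l) i * w i b := by
    intro l b
    simp [L, Module.Basis.constr_apply_fintype, Module.Basis.equivFun_apply]
  obtain ⟨μ, -, hn, hμ, hcal⟩ := exists_conformal_of_smith (o x) hc h e
  have hε := volumeForm_sq_of_orthonormal (o x) e
  set ε := (o x).volumeForm e with hεdef
  -- Passing from the coordinate frame to `e` multiplies a form of top degree by `det = ε D`, the
  -- same constant for every `y`.
  have hrel : ∀ y, calibrationCoord Q (u p) y w =
      ε * volumeDensity o p z * calibrationCoord Q (u p) y (fun l => L (e l)) := by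
    intro y
    have h1 := ((calibrationCoord Q (u p) y).toAlternatingMap.compLinearMap L).eq_smul_basis_det
      e.toBasis
    have h2 := congrFun (congrArg DFunLike.coe h1) (bs : Fin (k + 1) → TangentSpace (𝓡 (k + 1)) x)
    rw [AlternatingMap.smul_apply, ← volumeForm_mul_volumeForm (o x) e, ← hD, smul_eq_mul,
      mul_comm] at h2
    have h3 : ((calibrationCoord Q (u p) y).toAlternatingMap.compLinearMap L)
        (bs : Fin (k + 1) → TangentSpace (𝓡 (k + 1)) x) =
        calibrationCoord Q (u p) y w := by
      rw [← funext hLb]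
      rfl
    rw [← h3, h2]
    simp only [OrthonormalBasis.coe_toBasis]
    rfl
  have hfd : DifferentiableAt ℝ (fun y => calibrationCoord Q (u p) y (fun l => L (e l)))
      (chartMap u p z) :=
    (ContDiffAt.continuousAlternatingMap_apply (N := ∞) (v := fun l _ => L (e l))
      (contDiffAt_calibrationCoord hQ hyt) fun _ => contDiffAt_const).differentiableAt (by simp)
  have hHd : ∀ b d, DifferentiableAt ℝ (fun y => metricMatrix (u p) y b d) (chartMap u p z) :=
    fun b d => (contDiffAt_metricMatrix hyt b d).differentiableAt (by simp)
  have hpd : partialDeriv t (fun y => calibrationCoord Q (u p) y w) (chartMap u p z) =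
      ε * volumeDensity o p z * partialDeriv t
        (fun y => calibrationCoord Q (u p) y (fun l => L (e l))) (chartMap u p z) := by
    rw [funext hrel, partialDeriv, fderiv_const_mul hfd]
    rfl
  -- If `du` vanishes at the point, all frozen vectors are zero and so are both sides; otherwise the
  -- first variation applies.
  by_cases hμ0 : μ = 0
  · have hA : ∀ v, differential (n := k + 1) (m := m) u x v = 0 := by
      have : differential (n := k + 1) (m := m) u x = 0 := e.toBasis.ext fun i => by
        have := hn i
        rw [hμ0, norm_eq_zero] at this
        simpa using this
      simp [this]
    have hw0 : ∀ i, w i = 0 := fun i => by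
      have h1 := hfr i
      rw [hA] at h1
      rw [← coframe_frame (p := u p) hz' (w i)]
      exact (congrArg _ h1).trans (map_zero _)
    have hL0 : ∀ l, L (e l) = 0 := fun l => by
      rw [← coframe_frame (p := u p) hz' (L (e l)), hLA, hA, map_zero]
    have h2 : ∀ y, calibrationCoord Q (u p) y (fun l => L (e l)) = 0 := fun y =>
      (calibrationCoord Q (u p) y).map_coord_zero 0 (hL0 0)
    rw [hpd, funext h2]
    have h3 : ∀ i, chartMapDeriv u p i z = (0 : Euc m) := hw0
    simp [h3, partialDeriv]
  · set E : Euc m → ℝ := fun y => ∑ l, ∑ b, ∑ d,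
      metricMatrix (u p) y b d * L (e l) b * L (e l) d with hE
    have hterm : ∀ l b d, DifferentiableAt ℝ
        (fun y => metricMatrix (u p) y b d * L (e l) b * L (e l) d) (chartMap u p z) :=
      fun l b d => ((hHd b d).mul_const _).mul_const _
    have hEd : DifferentiableAt ℝ E (chartMap u p z) :=
      DifferentiableAt.fun_sum fun l _ => DifferentiableAt.fun_sum fun b _ =>
        DifferentiableAt.fun_sum fun d _ => hterm l b d
    have hEn : ∀ y, E y = ∑ l, ‖frame (u p) ((extChartAt (𝓡 m) (u p)).symm y) (L (e l))‖ ^ 2 := by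
      intro y
      refine Finset.sum_congr rfl fun l _ => ?_
      rw [← real_inner_self_eq_norm_sq, inner_frame_frame]
    have hfv := partialDeriv_eq_of_sq_le (Q (u x)).one_le hfd hEd
      -- The bound holds for arbitrary vectors in any tangent space, so `y` need not lie in the
      -- chart target.
      (fun y => by
        rw [hEn]
        exact (Q ((extChartAt (𝓡 m) (u p)).symm y)).inner_sq_le
          fun l => frame (u p) ((extChartAt (𝓡 m) (u p)).symm y) (L (e l)))
      hε hμ0 (hμ.resolve_left hμ0)
      (by
        rw [← hcal]
        have : (fun l => frame (u p) (u x) (L (e l))) = differential u x ∘ e :=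
          funext fun l => hLA _
        rw [← this, ← hsymm]
        rfl)
      (by
        rw [hEn, hsymm]
        simp only [hLA, hn]
        simp) t
    have hEpd : partialDeriv t E (chartMap u p z) = ∑ i, ∑ j, (metricMatrix p z)⁻¹ i j *
        ∑ b, ∑ d, partialDeriv t (fun y => metricMatrix (u p) y b d) (chartMap u p z) *
          w i b * w j d := by
      rw [hE, partialDeriv_sum fun l _ => DifferentiableAt.fun_sum fun b _ =>
        DifferentiableAt.fun_sum fun d _ => hterm l b d]
      simp only [hG, gram_inv_apply e]
      rw [← sum_quadratic_form_sum _ (fun l i => bs.repr (e l) i) fun i b => w i b]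
      refine Finset.sum_congr rfl fun l _ => ?_
      rw [partialDeriv_sum fun b _ => DifferentiableAt.fun_sum fun d _ => hterm l b d]
      refine Finset.sum_congr rfl fun b _ => ?_
      rw [partialDeriv_sum fun d _ => hterm l b d]
      refine Finset.sum_congr rfl fun d _ => ?_
      rw [← hLe, ← hLe, partialDeriv, fderiv_mul_const ((hHd b d).mul_const _),
        fderiv_mul_const (hHd b d)]
      simp only [smul_apply, smul_eq_mul, partialDeriv]
      ring
    rw [hpd, hfv, hEpd]
    linear_combination (1 / 2) * c ^ (k - 1) * volumeDensity o p z * (∑ i, ∑ j,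
      (metricMatrix p z)⁻¹ i j * ∑ b, ∑ d,
        partialDeriv t (fun y => metricMatrix (u p) y b d) (chartMap u p z) *
          w i b * w j d) * hε

end Coordinates

/-! ### Vanishing of the divergence of `Q(Λᵏ du)∗` -/

section Divergence

variable {k m : ℕ}
  {S : Type*} [TopologicalSpace S] [ChartedSpace (Euc (k + 1)) S] [IsManifold (𝓡 (k + 1)) ∞ S]
  [RiemannianBundle (fun x : S => TangentSpace (𝓡 (k + 1)) x)]
  {M : Type*} [TopologicalSpace M] [ChartedSpace (Euc m) M] [IsManifold (𝓡 m) ∞ M]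
  [RiemannianBundle (fun y : M => TangentSpace (𝓡 m) y)]
  {Q : ∀ y : M, VectorCrossProduct k (TangentSpace (𝓡 m) y)}
  {o : ∀ x : S, Orientation ℝ (TangentSpace (𝓡 (k + 1)) x) (Fin (k + 1))}
  {u : S → M} {p : S}

theorem sectionCoord_crossStarSection_eventuallyEq (hu : ContMDiff (𝓡 (k + 1)) (𝓡 m) ∞ u)
    (a : Fin m) (j : Fin (k + 1)) :
    sectionCoord u (crossStarSection o Q u) p a j =ᶠ[𝓝 (extChartAt (𝓡 (k + 1)) p p)]
      fun z => crossStarCoord o Q u p j z a := by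
  filter_upwards [eventually_mem_charts (n := k + 1) (m := m) (p := p) hu.continuous] with z hz
  exact sectionCoord_crossStarSection hu hz.1 hz.2 a j

theorem contDiffAt_sectionCoord_crossStarSection
    [IsContMDiffRiemannianBundle (𝓡 (k + 1)) ∞ (Euc (k + 1))
      (fun x : S => TangentSpace (𝓡 (k + 1)) x)]
    (ho : IsManifoldOrientation o)
    (hQ : IsSmoothVCP Q) (hu : ContMDiff (𝓡 (k + 1)) (𝓡 m) ∞ u) (a : Fin m) (j : Fin (k + 1)) :
    ContDiffAt ℝ ∞ (sectionCoord u (crossStarSection o Q u) p a j)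
      (extChartAt (𝓡 (k + 1)) p p) :=
  ((EuclideanSpace.proj a : Euc m →L[ℝ] ℝ).contDiff.contDiffAt.comp _
    (contDiffAt_crossStarCoord ho hQ hu j)).congr_of_eventuallyEq
    (sectionCoord_crossStarSection_eventuallyEq hu a j)

theorem sectionCoord_crossStarSection_eq_mul (hu : ContMDiff (𝓡 (k + 1)) (𝓡 m) ∞ u)
    {z : Euc (k + 1)}
    (hz : z ∈ (extChartAt (𝓡 (k + 1)) p).target)
    (hz' : u ((extChartAt (𝓡 (k + 1)) p).symm z) ∈ (extChartAt (𝓡 m) (u p)).source) {c : ℝ}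
    (h : exteriorPower.alternatingMapLinearEquiv
          (Q (u ((extChartAt (𝓡 (k + 1)) p).symm z))).toAlt.toAlternatingMap ∘ₗ
        exteriorPower.map k (differential u ((extChartAt (𝓡 (k + 1)) p).symm z)) =
      c ^ (k - 1) • (differential u ((extChartAt (𝓡 (k + 1)) p).symm z) ∘ₗ
        exteriorPower.alternatingMapLinearEquiv
          (hodgeStar (o ((extChartAt (𝓡 (k + 1)) p).symm z))))) (a : Fin m) (j : Fin (k + 1)) :
    sectionCoord u (crossStarSection o Q u) p a j z =
      ((-1) ^ k * c ^ (k - 1)) * chartMapDeriv u p j z a := by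
  have h1 := frame_fderiv_chartMap hu hz hz' (EuclideanSpace.single j 1)
  have h2 : coframe (u p) (u ((extChartAt (𝓡 (k + 1)) p).symm z))
      (differential u ((extChartAt (𝓡 (k + 1)) p).symm z)
        (coordVec p ((extChartAt (𝓡 (k + 1)) p).symm z) j)) =
        chartMapDeriv (m := m) u p j z := by
    rw [← coframe_frame (p := u p) hz' (chartMapDeriv (m := m) u p j z)]
    exact (congrArg _ h1).symm
  rw [sectionCoord, crossStarSection, crossStar_eq_smul _ h, LinearMap.smul_apply, map_smul, h2]
  rfl

theorem divergence_crossStarSection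
    [IsContMDiffRiemannianBundle (𝓡 (k + 1)) ∞ (Euc (k + 1))
      (fun x : S => TangentSpace (𝓡 (k + 1)) x)]
    [IsContMDiffRiemannianBundle (𝓡 m) ∞ (Euc m) (fun y : M => TangentSpace (𝓡 m) y)]
    (ho : IsManifoldOrientation o) (hQ : IsSmoothVCP Q)
    (hα : IsClosedForm fun y => (Q y).calibrationForm) (hu : IsSmithMap o Q u) (p : S) :
    divergence u (crossStarSection o Q u) p = 0 := by
  obtain ⟨hu, hs⟩ := hu
  -- The Smith equation enters at this single point only, so no regularity of the factor `c` in `x`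
  -- is required.
  obtain ⟨c, hc, h⟩ := hs ((extChartAt (𝓡 (k + 1)) p).symm (extChartAt (𝓡 (k + 1)) p p))
  have ht := mem_extChartAt_target (I := 𝓡 (k + 1)) p
  have hev := eventually_mem_charts (n := k + 1) (m := m) (p := p) hu.continuous
  have hyt := chartMap_self_mem_target (k := k) (m := m) (u := u) (p := p)
  have hU := (contDiffAt_chartMap (p := p) hu).differentiableAt (by simp)
  refine Finset.sum_eq_zero fun a _ => ?_
  have key := sum_inv_mul_covDeriv_eq_zero (z₀ := extChartAt (𝓡 (k + 1)) p p)
    (G := metricMatrix p) (D := volumeDensity o p) (U := chartMap u p)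
    (H := metricMatrix (u p)) (B := fun a j => sectionCoord u (crossStarSection o Q u) p a j)
    (N := crossStarDensity Q u p) (κ := (-1) ^ k * c ^ (k - 1))
    (fun i j => (contDiffAt_metricMatrix ht i j).differentiableAt (by simp))
    (metricMatrix_isSymm p) ((contDiffAt_volumeDensity ho).differentiableAt (by simp))
    (volumeDensity_ne_zero ht) (Filter.Eventually.of_forall volumeDensity_mul_self) hU
    (fun b d => (contDiffAt_metricMatrix hyt b d).differentiableAt (by simp))
    (metricMatrix_isSymm (u p)) (metricMatrix_det_ne_zero hyt)
    (fun b j => (contDiffAt_sectionCoord_crossStarSection ho hQ hu b j).differentiableAt (by simp))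
    (fun b j => (contDiffAt_crossStarDensity hQ hu b j).differentiableAt (by simp))
    (fun b j => by
      filter_upwards [hev] with z hz
      rw [← sum_metricMatrix_mul_crossStarCoord ((extChartAt (𝓡 m) (u p)).map_source hz.2)]
      exact Finset.sum_congr rfl fun d _ => by
        rw [sectionCoord_crossStarSection hu hz.1 hz.2])
    (fun b j => by
      rw [sectionCoord_crossStarSection_eq_mul hu ht hev.self_of_nhds.2 h, partialDeriv_apply hU]
      rfl)
    (fun b => by
      rw [sum_partialDeriv_crossStarDensity hQ hα hu,
        partialDeriv_calibrationCoord hQ hu ht hev.self_of_nhds.2 hc h]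
      simp only [partialDeriv_apply hU]
      simp only [chartMapDeriv]
      ring) a
  rw [chartMap_apply_self] at key
  exact (congrArg (· • coordVec (u p) (u p) a) key).trans (zero_smul ℝ _)

end Divergence

/-! ### Constant multiples of sections -/

section Scaling

variable {n m : ℕ}
  {S : Type*} [TopologicalSpace S] [ChartedSpace (Euc n) S] [IsManifold (𝓡 n) ∞ S]
  {M : Type*} [TopologicalSpace M] [ChartedSpace (Euc m) M] [IsManifold (𝓡 m) ∞ M]
  {u : S → M} {B : ∀ x : S, TangentSpace (𝓡 n) x →ₗ[ℝ] TangentSpace (𝓡 m) (u x)}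

theorem sectionCoord_const_smul (r : ℝ) (p : S) (a : Fin m) (j : Fin n) :
    sectionCoord u (fun x => r • B x) p a j = fun z => r * sectionCoord u B p a j z := by
  funext z
  simp only [sectionCoord, LinearMap.smul_apply, map_smul]
  rfl

theorem IsC1Section.const_smul (hB : IsC1Section u B) (r : ℝ) :
    IsC1Section u fun x => r • B x := fun p a j => by
  rw [sectionCoord_const_smul]
  exact contDiffAt_const.mul (hB p a j)

variable [RiemannianBundle (fun x : S => TangentSpace (𝓡 n) x)]
  [RiemannianBundle (fun y : M => TangentSpace (𝓡 m) y)]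

theorem divergence_const_smul (hB : IsC1Section u B) (r : ℝ) (p : S) :
    divergence u (fun x => r • B x) p = r • divergence u B p := by
  have h : ∀ i a j, covDerivCoord u (fun x => r • B x) p i a j = r * covDerivCoord u B p i a j := by
    intro i a j
    simp only [covDerivCoord, sectionCoord_const_smul]
    rw [partialDeriv, fderiv_const_mul ((hB p a j).differentiableAt (by simp)), smul_apply,
      mul_add, mul_sub, Finset.mul_sum, Finset.mul_sum]
    congr 2
    · exact Finset.sum_congr rfl fun l _ => by ring
    · funext b
      rw [Finset.mul_sum]
      exact Finset.sum_congr rfl fun c _ => by ring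
  simp only [divergence, h, Finset.smul_sum, smul_smul]
  refine Finset.sum_congr rfl fun a _ => ?_
  congr 1
  simp only [Finset.mul_sum]
  exact Finset.sum_congr rfl fun i _ => Finset.sum_congr rfl fun j _ => by ring

end Scaling

/-! ### The main theorem -/

theorem mainTheorem12 (k m : ℕ)
    (S : Type*) [TopologicalSpace S] [ChartedSpace (Euc (k + 1)) S]
    [IsManifold (𝓡 (k + 1)) ∞ S]
    [RiemannianBundle (fun x : S => TangentSpace (𝓡 (k + 1)) x)]
    [IsContMDiffRiemannianBundle (𝓡 (k + 1)) ∞ (Euc (k + 1))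
      (fun x : S => TangentSpace (𝓡 (k + 1)) x)]
    (o : ∀ x : S, Orientation ℝ (TangentSpace (𝓡 (k + 1)) x) (Fin (k + 1)))
    (ho : IsManifoldOrientation o)
    (M : Type*) [TopologicalSpace M] [ChartedSpace (Euc m) M] [IsManifold (𝓡 m) ∞ M]
    [RiemannianBundle (fun y : M => TangentSpace (𝓡 m) y)]
    [IsContMDiffRiemannianBundle (𝓡 m) ∞ (Euc m) (fun y : M => TangentSpace (𝓡 m) y)]
    (Q : ∀ y : M, VectorCrossProduct k (TangentSpace (𝓡 m) y)) (hQ : IsSmoothVCP Q)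
    (hα : IsClosedForm fun y => (Q y).calibrationForm)
    (u : S → M) (hu : IsSmithMap o Q u) :
    (IsC1Section u (crossStarSection o Q u) ∧
      ∀ x, divergence u (crossStarSection o Q u) x = 0) ∧
    IsPHarmonic (n := k + 1) (m := m) (k + 1) u := by
  have hC : IsC1Section u (crossStarSection o Q u) := fun p a j =>
    (contDiffAt_sectionCoord_crossStarSection ho hQ hu.1 a j).of_le (by simp)
  have hdiv : ∀ x, divergence u (crossStarSection o Q u) x = 0 :=
    divergence_crossStarSection ho hQ hα hu
  have hscaled : (fun x => scaledMap (V := TangentSpace (𝓡 (k + 1)) x)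
      (W := TangentSpace (𝓡 m) (u x)) (k + 1) (differential u x)) = fun x =>
      (√((k + 1 : ℕ) : ℝ) ^ (k - 1) * (-1) ^ k) • crossStarSection o Q u x :=
    funext fun x => scaledMap_eq_smul_crossStar (o x) (hu.2 x)
  refine ⟨⟨hC, hdiv⟩, hu.1, ?_, ?_⟩
  · rw [hscaled]
    exact hC.const_smul _
  · intro x
    rw [hscaled, divergence_const_smul hC, hdiv, smul_zero]
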